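/- Let $0<q<1$, let $n\ge 2$, $1\le l\le n/2$ and $1\le r\le l$ be integers, let $\sigma\in\mathbb R$, and write $k'=n+1-k$, $I'=\{i' : i\in I\}$. Let $A_q(U)$ be the complex algebra with generators $t_{ij}$ ($1\le i,j\le n$) and $\det_q^{-1}$, and relations $t_{ki}t_{kj}=q\,t_{kj}t_{ki}$, $t_{ik}t_{jk}=q\,t_{jk}t_{ik}$ ($i<j$), $t_{im}t_{kj}=t_{kj}t_{im}$, $t_{ij}t_{km}-t_{km}t_{ij}=(q-q^{-1})t_{im}t_{kj}$ ($i<k$, $j<m$), $\det_q\det_q^{-1}=\det_q^{-1}\det_q=1$, where $\det_q=\sum_{s\in\mathfrak S_n}(-q)^{\ell(s)}t_{1s(1)}\cdots t_{ns(n)}$. Put $t_{ij}^*=(-q)^{j-i}\,\xi^{i^c}_{j^c}\,\det_q^{-1}$, where $i^c=\{1,\dots,n\}\setminus\{i\}$ and $\xi^I_J=\sum_{s}(-q)^{\ell(s)}t_{i_1j_{s(1)}}\cdots t_{i_mj_{s(m)}}$ for $I=\{i_1<\dots<i_m\}$, $J=\{j_1<\dots<j_m\}$. Let $V=\mathbb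 C^n$ with basis $(v_i)$ and dual basis $(v_i^*)$ of $V^*$, with the right $A_q(U)$-coactions $v_j\mapsto\sum_i v_i\otimes t_{ij}$ and $v_j^*\mapsto\sum_i v_i^*\otimes t_{ij}^*$; tensor products carry the coaction $v\otimes w\mapsto\sum v_{(1)}\otimes w_{(1)}\otimes v_{(2)}w_{(2)}$. Let $\Lambda_q(V)$ (resp. $\Lambda_q(V^*)$) be the algebra generated by the $v_i$ (resp. $v_i^*$) with relations $v_i\wedge v_i=0$, $v_i\wedge v_j=-q^{-1}v_j\wedge v_i$ (resp. $v_i^*\wedge v_i^*=0$, $v_j^*\wedge v_i^*=-q^{-1}v_i^*\wedge v_j^*$) for $i<j$; the coaction of $V$ (resp. $V^*$) extends, uniquely, to an algebra homomorphism $\Lambda_q(V)\to\Lambda_q(V)\otimes A_q(U)$ (resp. $\Lambda_q(V^*)\to\Lambda_q(V^*)\otimes A_q(U)$), and this defines the coactions on the components $\Lambda_q^r(V)$, $\Lambda_q^r(V^*)$ of degree $r$. For $I=\{i_1<\dots<i_r\}$ write $v_I=v_{i_1}\wedge\dots\wedge v_{i_r}$ and $v_I^*=v_{i_r}^*\wedge\dots\wedge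 v_{i_1}^*$. Let $\mathrm{pr}_r\colon V^{\otimes r}\to\Lambda_q^r(V)$ and $\mathrm{pr}_r^*\colon (V^*)^{\otimes r}\to\Lambda_q^r(V^*)$ be the canonical projections. Let $\beta\colon V^*\otimes V\to V\otimes V^*$ be the linear map $$\beta(v_i^*\otimes v_j)=q^{-\delta_{ij}}v_j\otimes v_i^*+(q^{-1}-q)\delta_{ij}\sum_{k<j}v_k\otimes v_k^*,$$ and let $\Psi_r\colon (V_1\otimes V_1^*)\otimes\cdots\otimes(V_r\otimes V_r^*)\to(V_1\otimes\cdots\otimes V_r)\otimes(V_1^*\otimes\cdots\otimes V_r^*)$, with $V_i=V$, be $\Psi_r=\beta_{1r}\circ\beta_{2r}\circ\cdots\circ\beta_{r-1,r}\circ\cdots\circ\beta_{13}\circ\beta_{23}\circ\beta_{12}$, where $\beta_{ij}$ is $\beta$ on the factors $V_i^*\otimes V_j$ and the identity on the others. Put $\widehat\Psi_r=(\mathrm{pr}_r\otimes\mathrm{pr}_r^*)\circ\Psi_r$. For a vector $v$ in a right $A_q(U)$-comodule, its component $v_\mu$ of weight $\mu\in\mathbb Z^n$ is the coefficient of $z^\mu$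 when the coaction on $v$ is followed by the algebra homomorphism $A_q(U)\to\mathbb C[z_1^{\pm1},\dots,z_n^{\pm1}]$, $t_{ij}\mapsto\delta_{ij}z_i$. For $v\in\Lambda_q^r(V)\otimes\Lambda_q^r(V^*)$ the principal term is $$[v]=\sum_{\nu}v_{\nu^\flat},\qquad \nu^\flat=(\nu_1,\dots,\nu_l,0,\dots,0,-\nu_l,\dots,-\nu_1),$$ the sum being over the orbit of $(1^r)=(1,\dots,1,0,\dots,0)\in\mathbb Z^l$ under permutations and sign changes. Let $$u_r=\sum_I v_I\otimes v_{I'}^*,\qquad \tilde u_r=\sum_I q^{\sum_{i\in I'}2(n-i)}\,v_I\otimes v_{I'}^*,$$ the sums being over $I\subset\{1,\dots,l\}\cup\{l',\dots,n\}$ with $|I|=r$ and $I\cap I'=\emptyset$. Let $w^\sigma=\sum_{i,j}J^\sigma_{ij}v_i\otimes v_j^*$ and $\tilde w^\sigma=\sum_{i,j}\tilde J^\sigma_{ij}v_i\otimes v_j^*$, where, with matrix units $e_{ij}$, $$J^\sigma=\sum_{k\le l}(1-q^{2\sigma})e_{kk}+\sum_{l<k<l'}e_{kk}-\sum_{k\le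 l}q^\sigma e_{kk'}-\sum_{k\le l}q^\sigma e_{k'k},$$ $$\tilde J^\sigma=\sum_{k\le l}(1-q^{2(n-2l)}q^{2\sigma})e_{kk}+\sum_{l<k<l'}e_{kk}-q^{\sigma-1}\sum_{k\le l}q^{2(k-l)}e_{kk'}-q^{\sigma-1}\sum_{k\le l}q^{2(k'-l)}e_{k'k}.$$ Then $\widehat\Psi_r\colon(V\otimes V^*)^{\otimes r}\to\Lambda_q^r(V)\otimes\Lambda_q^r(V^*)$ is surjective and intertwines the right $A_q(U)$-coactions, and $$[\widehat\Psi_r((w^\sigma)^{\otimes r})]=c_r(\sigma)\,u_r,\qquad [\widehat\Psi_r((\tilde w^\sigma)^{\otimes r})]=\tilde c_r(\sigma)\,\tilde u_r,$$ with the nonzero constants $$c_r(\sigma)=\Bigl(\frac{q^\sigma}{q^2-1}\Bigr)^r(q^2;q^2)_r,\qquad \tilde c_r(\sigma)=\Bigl(\frac{q^{\sigma-1}q^{2(1-l)}}{q^2-1}\Bigr)^r(q^2;q^2)_r,\qquad (q^2;q^2)_r=\prod_{j=1}^r(1-q^{2j}).$$ -/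

import Mathlib

open scoped TensorProduct

noncomputable section

namespace QGrass

/-! ### The quantized coordinate ring -/

/-- Generators of the quantized coordinate ring: the `t i j` and the inverse `d` of the quantum
determinant. Indices `1, …, n` are represented by `Fin n`, i.e. by `0, …, n - 1`. -/
inductive Gen (n : ℕ) : Type
  | t (i j : Fin n) : Gen n
  | d : Gen n

/-- The length `l(s)` of a permutation (its number of inversions). -/
def permLength {r : ℕ} (s : Equiv.Perm (Fin r)) : ℕ :=
  (Finset.univ.filter fun p : Fin r × Fin r => p.1 < p.2 ∧ s p.2 < s p.1).card

/-- The quantum minor `∑ₛ (-q)^{l(s)} x_{a₁ b_{s(1)}} ⋯ x_{aᵣ b_{s(r)}}` with rows `a₁ < ⋯ < aᵣ` and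
columns `b₁ < ⋯ < bᵣ` of a matrix `x` over a (noncommutative) algebra. -/
def qMinor {n r : ℕ} {A : Type*} [Ring A] [Algebra ℂ A] (q : ℝ) (x : Fin n → Fin n → A)
    (a b : Fin r ↪o Fin n) : A :=
  ∑ s : Equiv.Perm (Fin r),
    (-(q : ℂ)) ^ permLength s • (List.ofFn fun k => x (a k) (b (s k))).prod

/-- The quantum determinant. -/
def qDet {n : ℕ} {A : Type*} [Ring A] [Algebra ℂ A] (q : ℝ) (x : Fin n → Fin n → A) : A :=
  qMinor q x (OrderIso.refl (Fin n)).toOrderEmbedding (OrderIso.refl (Fin n)).toOrderEmbedding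

/-- The defining relations of `A_q(GL(n, ℂ))`. -/
inductive AqRel (n : ℕ) (q : ℝ) : FreeAlgebra ℂ (Gen n) → FreeAlgebra ℂ (Gen n) → Prop
  | row (k i j : Fin n) (h : i < j) :
      AqRel n q (FreeAlgebra.ι ℂ (Gen.t k i) * FreeAlgebra.ι ℂ (Gen.t k j))
        ((q : ℂ) • (FreeAlgebra.ι ℂ (Gen.t k j) * FreeAlgebra.ι ℂ (Gen.t k i)))
  | col (k i j : Fin n) (h : i < j) :
      AqRel n q (FreeAlgebra.ι ℂ (Gen.t i k) * FreeAlgebra.ι ℂ (Gen.t j k))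
        ((q : ℂ) • (FreeAlgebra.ι ℂ (Gen.t j k) * FreeAlgebra.ι ℂ (Gen.t i k)))
  | comm (i k j l : Fin n) (hik : i < k) (hjl : j < l) :
      AqRel n q (FreeAlgebra.ι ℂ (Gen.t i l) * FreeAlgebra.ι ℂ (Gen.t k j))
        (FreeAlgebra.ι ℂ (Gen.t k j) * FreeAlgebra.ι ℂ (Gen.t i l))
  | cross (i k j l : Fin n) (hik : i < k) (hjl : j < l) :
      AqRel n q
        (FreeAlgebra.ι ℂ (Gen.t i j) * FreeAlgebra.ι ℂ (Gen.t k l)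
          - FreeAlgebra.ι ℂ (Gen.t k l) * FreeAlgebra.ι ℂ (Gen.t i j))
        (((q : ℂ) - (q : ℂ)⁻¹) •
          (FreeAlgebra.ι ℂ (Gen.t i l) * FreeAlgebra.ι ℂ (Gen.t k j)))
  | det_mul_d :
      AqRel n q (qDet q (fun i j => FreeAlgebra.ι ℂ (Gen.t i j)) * FreeAlgebra.ι ℂ Gen.d) 1
  | d_mul_det :
      AqRel n q (FreeAlgebra.ι ℂ Gen.d * qDet q (fun i j => FreeAlgebra.ι ℂ (Gen.t i j))) 1

/-- The quantized coordinate ring `A_q(U) = A_q(G)`, `G = GL(n, ℂ)`. -/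
abbrev Aq (n : ℕ) (q : ℝ) : Type := RingQuot (AqRel n q)

/-- The generator `t_{ij}`. -/
def t {n : ℕ} (q : ℝ) (i j : Fin n) : Aq n q :=
  RingQuot.mkAlgHom ℂ (AqRel n q) (FreeAlgebra.ι ℂ (Gen.t i j))

/-- The inverse `det_q⁻¹` of the quantum determinant. -/
def detInv (n : ℕ) (q : ℝ) : Aq n q :=
  RingQuot.mkAlgHom ℂ (AqRel n q) (FreeAlgebra.ι ℂ Gen.d)

/-- The increasing enumeration of `{1, …, n} \ {i}`. -/
def complEmb {n : ℕ} (i : Fin n) : Fin (n - 1) ↪o Fin n :=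
  ({i}ᶜ : Finset (Fin n)).orderEmbOfFin (by simp [Finset.card_compl])

/-- The antipode on generators: `S(t_{ij}) = (-q)^{i-j} ξ^{j^c}_{i^c} det_q⁻¹`. -/
def antipodeT {n : ℕ} (q : ℝ) (i j : Fin n) : Aq n q :=
  (-(q : ℂ)) ^ ((i : ℤ) - (j : ℤ)) • (qMinor q (t q) (complEmb j) (complEmb i) * detInv n q)

/-- The `*`-structure on generators: `t_{ij}^* = S(t_{ji})`. -/
def tStar {n : ℕ} (q : ℝ) (i j : Fin n) : Aq n q := antipodeT q j i

/-! ### Restriction to the torus and weights -/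

/-- The algebra `A(𝕋) = ℂ[z₁^{±1}, …, zₙ^{±1}]` of Laurent polynomials; the monomial `z^μ` is
`AddMonoidAlgebra.single μ 1`, for `μ ∈ P = ℤⁿ`. -/
abbrev Torus (n : ℕ) : Type := AddMonoidAlgebra ℂ (Fin n → ℤ)

/-- `z^μ`. -/
def zPow {n : ℕ} (μ : Fin n → ℤ) : Torus n := AddMonoidAlgebra.single μ 1

/-- The restriction on generators: `t_{ij} ↦ δ_{ij} z_i`, `det_q⁻¹ ↦ (z₁ ⋯ zₙ)⁻¹`. -/
def resGen (n : ℕ) : Gen n → Torus n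
  | Gen.t i j => if i = j then zPow (Pi.single i 1) else 0
  | Gen.d => zPow (fun _ => -1)

theorem zPow_mul {n : ℕ} (μ ν : Fin n → ℤ) : zPow μ * zPow ν = zPow (μ + ν) := by
  simp [zPow, AddMonoidAlgebra.single_mul_single]

theorem prod_zPow {n : ℕ} (s : Finset (Fin n)) (μ : Fin n → Fin n → ℤ) :
    ∏ i ∈ s, zPow (μ i) = zPow (∑ i ∈ s, μ i) := by
  classical
  induction s using Finset.induction_on with
  | empty => simp [zPow, AddMonoidAlgebra.one_def]
  | insert a s ha ih => rw [Finset.prod_insert ha, Finset.sum_insert ha, ih, zPow_mul]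

theorem qDet_diag {n : ℕ} (q : ℝ) :
    qDet q (fun i j => if i = j then zPow (Pi.single i 1) else (0 : Torus n))
      = zPow (fun _ => 1) := by
  classical
  unfold qDet qMinor
  rw [Finset.sum_eq_single (1 : Equiv.Perm (Fin n))]
  · have h1 : permLength (1 : Equiv.Perm (Fin n)) = 0 := by
      unfold permLength
      rw [Finset.card_eq_zero, Finset.filter_eq_empty_iff]
      rintro p - ⟨h, h'⟩
      exact absurd h (not_lt.mpr (le_of_lt h'))
    rw [h1, pow_zero, one_smul, List.prod_ofFn]
    simp only [Equiv.Perm.coe_one, id_eq, if_true]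
    rw [prod_zPow]
    congr 1
    funext j
    simp [Finset.sum_apply, Pi.single_apply]
  · intro s _ hs
    obtain ⟨k, hk⟩ : ∃ k, s k ≠ k := by
      by_contra h
      push Not at h
      exact hs (Equiv.ext h)
    rw [List.prod_ofFn, Finset.prod_eq_zero (Finset.mem_univ k), smul_zero]
    simp [Ne.symm hk]
  · simp

theorem map_qDet {n : ℕ} {A B : Type*} [Ring A] [Algebra ℂ A] [Ring B] [Algebra ℂ B] (q : ℝ)
    (f : A →ₐ[ℂ] B) (x : Fin n → Fin n → A) :
    f (qDet q x) = qDet q (fun i j => f (x i j)) := by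
  unfold qDet qMinor
  simp [map_sum, map_list_prod, List.map_ofFn, Function.comp_def]

theorem resGen_rel (n : ℕ) (q : ℝ) ⦃x y : FreeAlgebra ℂ (Gen n)⦄ (h : AqRel n q x y) :
    FreeAlgebra.lift ℂ (resGen n) x = FreeAlgebra.lift ℂ (resGen n) y := by
  have hd : FreeAlgebra.lift ℂ (resGen n)
      (qDet q (fun i j => FreeAlgebra.ι ℂ (Gen.t i j))) = zPow (fun _ => 1) := by
    rw [map_qDet]
    simp only [FreeAlgebra.lift_ι_apply, resGen]
    exact qDet_diag q
  have hz : zPow (fun _ : Fin n => (1 : ℤ)) * zPow (fun _ => -1) = 1 := by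
    rw [zPow_mul]
    have : ((fun _ : Fin n => (1 : ℤ)) + fun _ => -1) = 0 := by funext i; simp
    rw [this]; rfl
  cases h with
  | row k i j h =>
    have h' : i ≠ j := ne_of_lt h
    rw [map_smul]
    by_cases hki : k = i
    · subst hki; simp [resGen, h']
    · simp [resGen, hki]
  | col k i j h =>
    have h' : i ≠ j := ne_of_lt h
    rw [map_smul]
    by_cases hki : i = k
    · subst hki; simp [resGen, h'.symm]
    · simp [resGen, hki]
  | comm i k j l hik hjl => simp [mul_comm]
  | cross i k j l hik hjl =>
    have : i ≠ l ∨ k ≠ j := by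
      by_contra hc
      push Not at hc
      obtain ⟨rfl, rfl⟩ := hc
      exact absurd hik (not_lt.mpr hjl.le)
    rcases this with h | h <;> simp [resGen, h, mul_comm]
  | det_mul_d => rw [map_mul, hd, map_one, FreeAlgebra.lift_ι_apply]; exact hz
  | d_mul_det =>
    rw [map_mul, hd, map_one, FreeAlgebra.lift_ι_apply, mul_comm]; exact hz

/-- The restriction homomorphism `A_q(U) → A(𝕋)`, `t_{ij} ↦ δ_{ij} z_i`. -/
def res (n : ℕ) (q : ℝ) : Aq n q →ₐ[ℂ] Torus n :=
  RingQuot.liftAlgHom ℂ ⟨FreeAlgebra.lift ℂ (resGen n), resGen_rel n q⟩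

/-- The coefficient of `z^μ`. -/
def zCoeff {n : ℕ} (μ : Fin n → ℤ) : Torus n →ₗ[ℂ] ℂ :=
  Finsupp.lapply μ ∘ₗ (AddMonoidAlgebra.coeffLinearEquiv ℂ).toLinearMap

/-- For a right comodule `(M, ρ)` the weight component `v_μ` of `v`, that is the coefficient of
`z^μ` in `(id ⊗ res) (ρ v) = ∑_μ v_μ ⊗ z^μ`. -/
def weightComp {n : ℕ} {q : ℝ} {M : Type*} [AddCommMonoid M] [Module ℂ M]
    (ρ : M →ₗ[ℂ] M ⊗[ℂ] Aq n q) (μ : Fin n → ℤ) : M →ₗ[ℂ] M :=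
  (TensorProduct.rid ℂ M).toLinearMap ∘ₗ
    LinearMap.lTensor M (zCoeff μ ∘ₗ (res n q).toLinearMap) ∘ₗ ρ

/-- The weight vectors of weight `μ` in a right comodule: `(id ⊗ res) (ρ v) = v ⊗ z^μ`. -/
def IsWeightVector {n : ℕ} {q : ℝ} {M : Type*} [AddCommMonoid M] [Module ℂ M]
    (ρ : M →ₗ[ℂ] M ⊗[ℂ] Aq n q) (μ : Fin n → ℤ) (v : M) : Prop :=
  LinearMap.lTensor M (res n q).toLinearMap (ρ v) = v ⊗ₜ[ℂ] zPow μ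

/-- `weightComp` is the projection onto weight components: it picks `v_μ` out of a finite sum of
weight vectors. -/
theorem weightComp_sum {n : ℕ} {q : ℝ} {M : Type*} [AddCommMonoid M] [Module ℂ M]
    (ρ : M →ₗ[ℂ] M ⊗[ℂ] Aq n q) (s : Finset (Fin n → ℤ)) (v : (Fin n → ℤ) → M)
    (hv : ∀ μ ∈ s, IsWeightVector ρ μ (v μ)) (ν : Fin n → ℤ) :
    weightComp ρ ν (∑ μ ∈ s, v μ) = if ν ∈ s then v ν else 0 := by
  classical
  have key : ∀ μ ∈ s, weightComp ρ ν (v μ) = if μ = ν then v μ else 0 := by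
    intro μ hμ
    have h := hv μ hμ
    unfold IsWeightVector at h
    simp only [weightComp, LinearMap.lTensor_comp, LinearMap.comp_apply, h]
    simp [zCoeff, zPow, Finsupp.single_apply]
  rw [map_sum, Finset.sum_congr rfl key, Finset.sum_ite_eq' s ν v]

/-! ### Comodules -/

/-- The right coaction `e_j ↦ ∑_i e_i ⊗ x_{ij}` given by a matrix `x`. -/
def matrixCoaction {n : ℕ} {q : ℝ} {ι M : Type*} [Fintype ι] [AddCommMonoid M] [Module ℂ M]
    (b : Module.Basis ι ℂ M) (x : ι → ι → Aq n q) : M →ₗ[ℂ] M ⊗[ℂ] Aq n q :=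
  b.constr ℂ fun j => ∑ i, b i ⊗ₜ[ℂ] x i j

/-- The tensor product of two right coactions: `v ⊗ w ↦ ∑ v₍₁₎ ⊗ w₍₁₎ ⊗ v₍₂₎ w₍₂₎`. -/
def tensorCoaction {n : ℕ} {q : ℝ} {M N : Type*} [AddCommMonoid M] [Module ℂ M]
    [AddCommMonoid N] [Module ℂ N]
    (ρ : M →ₗ[ℂ] M ⊗[ℂ] Aq n q) (ρ₂ : N →ₗ[ℂ] N ⊗[ℂ] Aq n q) :
    M ⊗[ℂ] N →ₗ[ℂ] (M ⊗[ℂ] N) ⊗[ℂ] Aq n q :=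
  LinearMap.lTensor (M ⊗[ℂ] N) (LinearMap.mul' ℂ (Aq n q)) ∘ₗ
    (TensorProduct.tensorTensorTensorComm ℂ M (Aq n q) N (Aq n q)).toLinearMap ∘ₗ
      TensorProduct.map ρ ρ₂

/-- `f` intertwines the right coactions `ρ` on `M` and `ρ₂` on `N`. -/
def IsIntertwiner {n : ℕ} {q : ℝ} {M N : Type*} [AddCommMonoid M] [Module ℂ M]
    [AddCommMonoid N] [Module ℂ N]
    (ρ : M →ₗ[ℂ] M ⊗[ℂ] Aq n q) (ρ₂ : N →ₗ[ℂ] N ⊗[ℂ] Aq n q) (f : M →ₗ[ℂ] N) : Prop :=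
  ρ₂ ∘ₗ f = LinearMap.rTensor (Aq n q) f ∘ₗ ρ

/-- The vector space `V = ℂⁿ`. -/
abbrev V (n : ℕ) : Type := Fin n → ℂ

/-- The dual space `V^*`. -/
abbrev Vd (n : ℕ) : Type := Module.Dual ℂ (V n)

/-- The canonical basis `(v_i)` of `V`. -/
def bV (n : ℕ) : Module.Basis (Fin n) ℂ (V n) := Pi.basisFun ℂ (Fin n)

/-- The dual basis `(v_i^*)` of `V^*`. -/
def bVd (n : ℕ) : Module.Basis (Fin n) ℂ (Vd n) := (bV n).dualBasis

/-- The basis `v_i ⊗ v_j^*` of `V ⊗ V^*`. -/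
def bVVd (n : ℕ) : Module.Basis (Fin n × Fin n) ℂ (V n ⊗[ℂ] Vd n) := (bV n).tensorProduct (bVd n)

/-- The tensor power `(V ⊗ V^*)^{⊗ r}`. -/
abbrev Src (n r : ℕ) : Type := PiTensorProduct ℂ fun _ : Fin r => V n ⊗[ℂ] Vd n

/-- The basis `(v_{a₁} ⊗ v_{b₁}^*) ⊗ ⋯ ⊗ (v_{aᵣ} ⊗ v_{bᵣ}^*)` of `(V ⊗ V^*)^{⊗ r}`. -/
def bSrc (n r : ℕ) : Module.Basis (Fin r → Fin n × Fin n) ℂ (Src n r) :=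
  Basis.piTensorProduct fun _ => bVVd n

/-- The tensor product coaction on `(V ⊗ V^*)^{⊗ r}`: the matrix coefficients of a tensor product
are the products, in the order of the factors, of those of the factors `V, V^*, V, V^*, …`, where
`V` is the vector corepresentation `v_j ↦ ∑_i v_i ⊗ t_{ij}` and `V^*` its contragredient
`v_j^* ↦ ∑_i v_i^* ⊗ t_{ij}^*`. -/
def coactSrc (n : ℕ) (q : ℝ) (r : ℕ) : Src n r →ₗ[ℂ] Src n r ⊗[ℂ] Aq n q :=
  matrixCoaction (bSrc n r) fun y x =>
    (List.ofFn fun k : Fin r => t q (y k).1 (x k).1 * tStar q (y k).2 (x k).2).prod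

/-! ### The exterior algebras -/

/-- The relations of `Λ_q(V)`. -/
inductive LRel (n : ℕ) (q : ℝ) : FreeAlgebra ℂ (Fin n) → FreeAlgebra ℂ (Fin n) → Prop
  | sq (i : Fin n) : LRel n q (FreeAlgebra.ι ℂ i * FreeAlgebra.ι ℂ i) 0
  | swap (i j : Fin n) (h : i < j) :
      LRel n q (FreeAlgebra.ι ℂ i * FreeAlgebra.ι ℂ j)
        ((-(q : ℂ)⁻¹) • (FreeAlgebra.ι ℂ j * FreeAlgebra.ι ℂ i))

/-- The relations of `Λ_q(V^*)`. -/
inductive LdRel (n : ℕ) (q : ℝ) : FreeAlgebra ℂ (Fin n) → FreeAlgebra ℂ (Fin n) → Prop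
  | sq (i : Fin n) : LdRel n q (FreeAlgebra.ι ℂ i * FreeAlgebra.ι ℂ i) 0
  | swap (i j : Fin n) (h : i < j) :
      LdRel n q (FreeAlgebra.ι ℂ j * FreeAlgebra.ι ℂ i)
        ((-(q : ℂ)⁻¹) • (FreeAlgebra.ι ℂ i * FreeAlgebra.ι ℂ j))

/-- The exterior algebra `Λ_q(V)`. -/
abbrev L (n : ℕ) (q : ℝ) : Type := RingQuot (LRel n q)

/-- The exterior algebra `Λ_q(V^*)`. -/
abbrev Ld (n : ℕ) (q : ℝ) : Type := RingQuot (LdRel n q)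

/-- The generators `v_i` of `Λ_q(V)`. -/
def lv {n : ℕ} (q : ℝ) (i : Fin n) : L n q := RingQuot.mkAlgHom ℂ (LRel n q) (FreeAlgebra.ι ℂ i)

/-- The generators `v_i^*` of `Λ_q(V^*)`. -/
def ldv {n : ℕ} (q : ℝ) (i : Fin n) : Ld n q :=
  RingQuot.mkAlgHom ℂ (LdRel n q) (FreeAlgebra.ι ℂ i)

/-- The product `v_{a₁} ∧ ⋯ ∧ v_{aᵣ}`. -/
def lword {n r : ℕ} (q : ℝ) (a : Fin r → Fin n) : L n q := (List.ofFn fun k => lv q (a k)).prod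

/-- The product `v_{a₁}^* ∧ ⋯ ∧ v_{aᵣ}^*`. -/
def ldword {n r : ℕ} (q : ℝ) (a : Fin r → Fin n) : Ld n q := (List.ofFn fun k => ldv q (a k)).prod

/-- The component `Λ_q^r(V)` of degree `r`. -/
def LPow (n : ℕ) (q : ℝ) (r : ℕ) : Submodule ℂ (L n q) :=
  Submodule.span ℂ (Set.range fun a : Fin r → Fin n => lword q a)

/-- The component `Λ_q^r(V^*)` of degree `r`. -/
def LdPow (n : ℕ) (q : ℝ) (r : ℕ) : Submodule ℂ (Ld n q) :=
  Submodule.span ℂ (Set.range fun a : Fin r → Fin n => ldword q a)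

/-- `v_I = v_{i₁} ∧ ⋯ ∧ v_{iᵣ}` for `I = {i₁ < ⋯ < iᵣ}`. -/
def vI {n : ℕ} (q : ℝ) (I : Finset (Fin n)) : L n q :=
  ((I.sort (· ≤ ·)).map (lv q)).prod

/-- `v_I^* = v_{iᵣ}^* ∧ ⋯ ∧ v_{i₁}^*` for `I = {i₁ < ⋯ < iᵣ}`. -/
def vdI {n : ℕ} (q : ℝ) (I : Finset (Fin n)) : Ld n q :=
  ((I.sort (· ≤ ·)).reverse.map (ldv q)).prod

/-- An algebra homomorphism `Λ_q(V) → Λ_q(V) ⊗ A_q(U)` is the coaction on `Λ_q(V)` if it extends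
the coaction `v_j ↦ ∑_i v_i ⊗ t_{ij}` of `V`. There is at most one such homomorphism. -/
def IsCoactionL {n : ℕ} {q : ℝ} (ρ : L n q →ₐ[ℂ] L n q ⊗[ℂ] Aq n q) : Prop :=
  ∀ j, ρ (lv q j) = ∑ i, lv q i ⊗ₜ[ℂ] t q i j

/-- An algebra homomorphism `Λ_q(V^*) → Λ_q(V^*) ⊗ A_q(U)` is the coaction on `Λ_q(V^*)` if it
extends the coaction `v_j^* ↦ ∑_i v_i^* ⊗ t_{ij}^*` of `V^*`. There is at most one such
homomorphism. -/
def IsCoactionLd {n : ℕ} {q : ℝ} (ρ : Ld n q →ₐ[ℂ] Ld n q ⊗[ℂ] Aq n q) : Prop :=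
  ∀ j, ρ (ldv q j) = ∑ i, ldv q i ⊗ₜ[ℂ] tStar q i j

theorem IsCoactionL.unique {n : ℕ} {q : ℝ} {ρ ρ₂ : L n q →ₐ[ℂ] L n q ⊗[ℂ] Aq n q}
    (h : IsCoactionL ρ) (h₂ : IsCoactionL ρ₂) : ρ = ρ₂ := by
  apply RingQuot.ringQuot_ext'
  apply FreeAlgebra.hom_ext
  funext j
  exact (h j).trans (h₂ j).symm

theorem IsCoactionLd.unique {n : ℕ} {q : ℝ} {ρ ρ₂ : Ld n q →ₐ[ℂ] Ld n q ⊗[ℂ] Aq n q}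
    (h : IsCoactionLd ρ) (h₂ : IsCoactionLd ρ₂) : ρ = ρ₂ := by
  apply RingQuot.ringQuot_ext'
  apply FreeAlgebra.hom_ext
  funext j
  exact (h j).trans (h₂ j).symm

/-! ### The map `Ψ̂_r` -/

/-- The tensor power `V^{⊗ r}`. -/
abbrev VPow (n r : ℕ) : Type := PiTensorProduct ℂ fun _ : Fin r => V n

/-- The tensor power `(V^*)^{⊗ r}`. -/
abbrev VdPow (n r : ℕ) : Type := PiTensorProduct ℂ fun _ : Fin r => Vd n

/-- The basis `v_{a₁} ⊗ ⋯ ⊗ v_{aᵣ}` of `V^{⊗ r}`. -/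
def bVPow (n r : ℕ) : Module.Basis (Fin r → Fin n) ℂ (VPow n r) :=
  Basis.piTensorProduct fun _ => bV n

/-- The basis `v_{a₁}^* ⊗ ⋯ ⊗ v_{aᵣ}^*` of `(V^*)^{⊗ r}`. -/
def bVdPow (n r : ℕ) : Module.Basis (Fin r → Fin n) ℂ (VdPow n r) :=
  Basis.piTensorProduct fun _ => bVd n

/-- The basis `v_{a₁} ⊗ ⋯ ⊗ v_{aᵣ} ⊗ v_{b₁}^* ⊗ ⋯ ⊗ v_{bᵣ}^*` of `V^{⊗ r} ⊗ (V^*)^{⊗ r}`. -/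
def bMix (n r : ℕ) :
    Module.Basis ((Fin r → Fin n) × (Fin r → Fin n)) ℂ (VPow n r ⊗[ℂ] VdPow n r) :=
  (bVPow n r).tensorProduct (bVdPow n r)

/-- The map `β : V^* ⊗ V → V ⊗ V^*`,
`β(v_i^* ⊗ v_j) = q^{-δ_{ij}} v_j ⊗ v_i^* + (q⁻¹ - q) δ_{ij} ∑_{k<j} v_k ⊗ v_k^*`. -/
def beta (n : ℕ) (q : ℝ) : Vd n ⊗[ℂ] V n →ₗ[ℂ] V n ⊗[ℂ] Vd n :=
  ((bVd n).tensorProduct (bV n)).constr ℂ fun p =>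
    (if p.1 = p.2 then (q : ℂ)⁻¹ else 1) • (bV n p.2 ⊗ₜ[ℂ] bVd n p.1)
      + (if p.1 = p.2 then (q : ℂ)⁻¹ - (q : ℂ) else 0) •
        ∑ k ∈ Finset.univ.filter (fun k => k < p.2), bV n k ⊗ₜ[ℂ] bVd n k

/-- The map `β_{ij}`, which applies `β` to the factors `V_i^* ⊗ V_j` and is the identity on all
other factors. A tensor product of the labelled factors `V_1, …, V_r, V_1^*, …, V_r^*`, in whatever
order they stand, is identified with `(V_1 ⊗ ⋯ ⊗ V_r) ⊗ (V_1^* ⊗ ⋯ ⊗ V_r^*)` by rearranging the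
factors, so that `β_{ij}` becomes an endomorphism of that space. -/
def betaAt (n : ℕ) (q : ℝ) {r : ℕ} (i j : Fin r) : Module.End ℂ (VPow n r ⊗[ℂ] VdPow n r) :=
  (bMix n r).constr ℂ fun p =>
    ∑ k, ∑ m, (bVVd n).repr (beta n q (bVd n (p.2 i) ⊗ₜ[ℂ] bV n (p.1 j))) (k, m) •
      bMix n r (Function.update p.1 j k, Function.update p.2 i m)

/-- The rearrangement of factors
`(V_1 ⊗ V_1^*) ⊗ ⋯ ⊗ (V_r ⊗ V_r^*) ≃ (V_1 ⊗ ⋯ ⊗ V_r) ⊗ (V_1^* ⊗ ⋯ ⊗ V_r^*)`. -/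
def regroup (n r : ℕ) : Src n r ≃ₗ[ℂ] VPow n r ⊗[ℂ] VdPow n r :=
  (bSrc n r).equiv (bMix n r) 
    (Equiv.arrowProdEquivProdArrow (Fin r) (fun _ => Fin n) (fun _ => Fin n))

/-- `Ψ_r = (β_{1r} ∘ ⋯ ∘ β_{r-1,r}) ∘ ⋯ ∘ (β_{13} ∘ β_{23}) ∘ β_{12}`. -/
def Psi (n : ℕ) (q : ℝ) (r : ℕ) : Src n r →ₗ[ℂ] VPow n r ⊗[ℂ] VdPow n r :=
  (((List.finRange r).reverse.map fun j =>
      (((List.finRange r).filter fun i => i < j).map fun i => betaAt n q i j).prod).prod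
    : Module.End ℂ (VPow n r ⊗[ℂ] VdPow n r)) ∘ₗ (regroup n r).toLinearMap

/-- The canonical projection `V^{⊗ r} → Λ_q^r(V)`. -/
def pr (n : ℕ) (q : ℝ) (r : ℕ) : VPow n r →ₗ[ℂ] LPow n q r :=
  (bVPow n r).constr ℂ fun a => ⟨lword q a, Submodule.subset_span ⟨a, rfl⟩⟩

/-- The canonical projection `(V^*)^{⊗ r} → Λ_q^r(V^*)`. -/
def prd (n : ℕ) (q : ℝ) (r : ℕ) : VdPow n r →ₗ[ℂ] LdPow n q r :=
  (bVdPow n r).constr ℂ fun a => ⟨ldword q a, Submodule.subset_span ⟨a, rfl⟩⟩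

/-- `Ψ̂_r = (pr_r ⊗ pr_r^*) ∘ Ψ_r`. -/
def PsiHat (n : ℕ) (q : ℝ) (r : ℕ) : Src n r →ₗ[ℂ] LPow n q r ⊗[ℂ] LdPow n q r :=
  TensorProduct.map (pr n q r) (prd n q r) ∘ₗ Psi n q r

/-- The inclusion of `Λ_q^r(V) ⊗ Λ_q^r(V^*)` in `Λ_q(V) ⊗ Λ_q(V^*)`. -/
def incl (n : ℕ) (q : ℝ) (r : ℕ) : LPow n q r ⊗[ℂ] LdPow n q r →ₗ[ℂ] L n q ⊗[ℂ] Ld n q :=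
  TensorProduct.mapIncl (LPow n q r) (LdPow n q r)

/-! ### Principal terms and the vectors of the theorem -/

/-- The weight `ν^♭ = (ν₁, …, ν_l, 0, …, 0, -ν_l, …, -ν₁) ∈ ℤⁿ` for `ν ∈ ℤ^l`. -/
def flat (n : ℕ) {l : ℕ} (ν : Fin l → ℤ) (i : Fin n) : ℤ :=
  if h : (i : ℕ) < l then ν ⟨i, h⟩
  else if h : (i.rev : ℕ) < l then -ν ⟨i.rev, h⟩ else 0

/-- The orbit `𝒲(1^r)` in `ℤ^l` under permutations and sign changes,
`(1^r) = (1, …, 1, 0, …, 0)` with `r` ones. -/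
def orbit (l r : ℕ) : Finset (Fin l → ℤ) :=
  (Finset.univ : Finset ((Fin l → ℤˣ) × Equiv.Perm (Fin l))).image fun w i =>
    (w.1 i : ℤ) * (if (w.2 i : ℕ) < r then 1 else 0)

/-- The principal term `[v] = ∑_{ν ∈ 𝒲(1^r)} v_{ν^♭}`. -/
def principalTerm {n : ℕ} {q : ℝ} {M : Type*} [AddCommMonoid M] [Module ℂ M]
    (ρ : M →ₗ[ℂ] M ⊗[ℂ] Aq n q) (l r : ℕ) (v : M) : M :=
  ∑ ν ∈ orbit l r, weightComp ρ (flat n ν) v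

/-- The matrix `J^σ`; here `k' = n + 1 - k` is `Fin.rev`. -/
def J (n l : ℕ) (q σ : ℝ) (i j : Fin n) : ℝ :=
  (if i = j ∧ (i : ℕ) < l then 1 - q ^ (2 * σ) else 0)
    + (if i = j ∧ l ≤ (i : ℕ) ∧ (i : ℕ) < n - l then 1 else 0)
    - (if j = i.rev ∧ (i : ℕ) < l then q ^ σ else 0)
    - (if i = j.rev ∧ (j : ℕ) < l then q ^ σ else 0)

/-- The matrix `J̃^σ`. Since indices start at `0` here, the entry `i` stands for `k = i + 1`. -/
def Jt (n l : ℕ) (q σ : ℝ) (i j : Fin n) : ℝ :=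
  (if i = j ∧ (i : ℕ) < l then 1 - q ^ (2 * ((n : ℤ) - 2 * (l : ℤ))) * q ^ (2 * σ) else 0)
    + (if i = j ∧ l ≤ (i : ℕ) ∧ (i : ℕ) < n - l then 1 else 0)
    - (if j = i.rev ∧ (i : ℕ) < l then
        q ^ (σ - 1) * q ^ (2 * (((i : ℕ) : ℤ) + 1 - (l : ℤ))) else 0)
    - (if i = j.rev ∧ (j : ℕ) < l then
        q ^ (σ - 1) * q ^ (2 * (((i : ℕ) : ℤ) + 1 - (l : ℤ))) else 0)

/-- `∑_{ij} X_{ij} v_i ⊗ v_j^*`. -/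
def vecOf {n : ℕ} (X : Fin n → Fin n → ℝ) : V n ⊗[ℂ] Vd n :=
  ∑ i, ∑ j, (X i j : ℂ) • (bV n i ⊗ₜ[ℂ] bVd n j)

/-- `w^σ`. -/
def w (n l : ℕ) (q σ : ℝ) : V n ⊗[ℂ] Vd n := vecOf (J n l q σ)

/-- `w̃^σ`. -/
def wt (n l : ℕ) (q σ : ℝ) : V n ⊗[ℂ] Vd n := vecOf (Jt n l q σ)

/-- `x^{⊗ r}`. -/
def pow {n : ℕ} (r : ℕ) (x : V n ⊗[ℂ] Vd n) : Src n r := PiTensorProduct.tprod ℂ fun _ => x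

/-- The sets `I ⊂ [1,l] ∪ [l',n]` with `|I| = r` and `I ∩ I' = ∅`. -/
def idx (n l r : ℕ) : Finset (Finset (Fin n)) :=
  Finset.univ.filter fun I =>
    (∀ i ∈ I, (i : ℕ) < l ∨ (i.rev : ℕ) < l) ∧ I.card = r ∧ I ∩ I.image Fin.rev = ∅

/-- `⟨2ρ, ε_I⟩` for `ρ = ∑_k (n - k) ε_k`; the entry `i` stands for `k = i + 1`. -/
def twoRho {n : ℕ} (I : Finset (Fin n)) : ℤ :=
  ∑ i ∈ I, 2 * ((n : ℤ) - (((i : ℕ) : ℤ) + 1))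

/-- `u_r = ∑_I v_I ⊗ v_{I'}^*`. -/
def u (n l : ℕ) (q : ℝ) (r : ℕ) : L n q ⊗[ℂ] Ld n q :=
  ∑ I ∈ idx n l r, vI q I ⊗ₜ[ℂ] vdI q (I.image Fin.rev)

/-- `ũ_r = ∑_I q^{⟨2ρ, ε_{I'}⟩} v_I ⊗ v_{I'}^*`. -/
def ut (n l : ℕ) (q : ℝ) (r : ℕ) : L n q ⊗[ℂ] Ld n q :=
  ∑ I ∈ idx n l r,
    ((q : ℂ) ^ twoRho (I.image Fin.rev)) • (vI q I ⊗ₜ[ℂ] vdI q (I.image Fin.rev))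

/-- The `q`-shifted factorial `(a; p)_m = ∏_{j < m} (1 - p^j a)`. -/
def qPoch (a p : ℝ) (m : ℕ) : ℝ := ∏ j ∈ Finset.range m, (1 - p ^ j * a)

/-- `c_r(σ) = (q^σ / (q² - 1))^r (q²; q²)_r`. -/
def c (q : ℝ) (r : ℕ) (σ : ℝ) : ℝ := (q ^ σ / (q ^ 2 - 1)) ^ r * qPoch (q ^ 2) (q ^ 2) r

/-- `c̃_r(σ) = (q^{σ-1} q^{2(1-l)} / (q² - 1))^r (q²; q²)_r`. -/
def ct (l : ℕ) (q : ℝ) (r : ℕ) (σ : ℝ) : ℝ :=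
  (q ^ (σ - 1) * q ^ (2 * (1 - (l : ℤ))) / (q ^ 2 - 1)) ^ r * qPoch (q ^ 2) (q ^ 2) r

end QGrass

end

/-!
For the braiding matrix `R`, the relations of the `t_{ij}` say that `R` commutes with `t₁ t₂`.
Inverting this equation shows that the reversed matrix of the `t_{ij}^*` satisfies the same
relations, so that both coactions extend to the exterior algebras; conjugating it gives an
exchange relation between `t_{ij}^*` and `t_{ij}`, so that `β` is an intertwiner. The inverse matrix
itself comes from the Laplace expansions, obtained by comparing coefficients of the top form in
`Λ_q(V) ⊗ A_q(U)`. Each `β_{ij}` is triangular with nonzero diagonal, which gives surjectivity.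

An intertwiner preserves weight components. As `J^σ` and `J̃^σ` are supported on the diagonal and
the antidiagonal, the component of `w^{⊗ r}` of weight `∑_{i ∈ I} (ε_i - ε_{i'})` only involves
the words `⨂_k v_{a_k} ⊗ v_{a_k'}^*` with `{a_1, …, a_r} = I`. When `I ∩ I' = ∅`, no index of a
`v` meets that of a `v^*` in such a word, and `Ψ_r` merely regroups its factors. The elements
`v_i ⊗ v_{i'}^*` of `Λ_q(V) ⊗ Λ_q(V^*)` have square zero and commute up to `q²`, so summing over
the orderings of `I` gives the `q²`-factorial of `r` times `v_I ⊗ v_{I'}^*`.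
-/

namespace QGrass

/-! ### Quantum matrices and the braiding -/

section QuantumMatrix

open scoped Kronecker

variable {ι K A : Type*} [LinearOrder ι] [Field K] [Ring A] [Algebra K A]

/-- A quantum matrix: its entries satisfy the commutation relations of the generators `t_{ij}` of
`A_q(U)`. -/
structure IsQuantumMatrix (q : K) (x : Matrix ι ι A) : Prop where
  row : ∀ k i j, i < j → x k i * x k j = q • (x k j * x k i)
  col : ∀ k i j, i < j → x i k * x j k = q • (x j k * x i k)
  comm : ∀ i k j m, i < k → j < m → x i m * x k j = x k j * x i m
  cross : ∀ i k j m, i < k → j < m →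
    x i j * x k m = x k m * x i j + (q - q⁻¹) • (x i m * x k j)

/-- The Hecke-type solution of the braid equation attached to the vector corepresentation. Its
`((i, k), (j, m))` entry is the coefficient of `v_k ⊗ v_m^*` in `β (v_i^* ⊗ v_j)`. -/
def braiding (q : K) : Matrix (ι × ι) (ι × ι) K := fun p s =>
  (if p = s.swap then if p.1 = p.2 then q⁻¹ else 1 else 0)
    + if p = s ∧ p.2 < p.1 then q⁻¹ - q else 0

theorem IsQuantumMatrix.transpose {q : K} {x : Matrix ι ι A} (hx : IsQuantumMatrix q x) :
    IsQuantumMatrix q x.transpose where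
  row k i j hij := hx.col k i j hij
  col k i j hij := hx.row k i j hij
  comm i k j m hik hjm := (hx.comm j m i k hjm hik).symm
  cross i k j m hik hjm := by
    simp only [Matrix.transpose_apply]
    rw [hx.cross j m i k hjm hik, hx.comm j m i k hjm hik]

/-- The relation `R x₁ x₂ = x₁ x₂ R` for the braiding `R`, written out in the entries of `x`. -/
def BraidingRelation (q : K) (x : Matrix ι ι A) : Prop :=
  ∀ a b i j, (if a = b then q⁻¹ else 1) • (x b i * x a j)
      + (if b < a then q⁻¹ - q else 0) • (x a i * x b j)
    = (if i = j then q⁻¹ else 1) • (x a j * x b i)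
      + (if j < i then q⁻¹ - q else 0) • (x a i * x b j)

theorem IsQuantumMatrix.braidingRelation {q : K} (hq : q ≠ 0) {x : Matrix ι ι A}
    (hx : IsQuantumMatrix q x) : BraidingRelation q x := by
  intro a b i j
  rcases lt_trichotomy a b with hab | rfl | hab <;> rcases lt_trichotomy i j with hij | rfl | hij
  · simp only [hab.ne, hab.not_gt, hij.ne, hij.not_gt, if_false, one_smul, zero_smul, add_zero]
    rw [hx.comm a b i j hab hij]
  · simp only [hab.ne, hab.not_gt, lt_irrefl, if_true, if_false, one_smul, zero_smul, add_zero]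
    rw [hx.col i a b hab, smul_smul, inv_mul_cancel₀ hq, one_smul]
  · simp only [hab.ne, hab.not_gt, hij.ne', hij, if_true, if_false, one_smul, zero_smul, add_zero]
    rw [hx.cross a b j i hab hij]
    module
  · simp only [lt_irrefl, hij.ne, hij.not_gt, if_true, if_false, one_smul, zero_smul, add_zero]
    rw [hx.row a i j hij, smul_smul, inv_mul_cancel₀ hq, one_smul]
  · simp only [lt_irrefl, if_false]
  · simp only [lt_irrefl, hij.ne', hij, if_true, if_false, one_smul, zero_smul, add_zero]
    rw [hx.row a j i hij]
    module
  · simp only [hab.ne', hab, hij.ne, hij.not_gt, if_true, if_false, one_smul, zero_smul, add_zero]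
    rw [hx.cross b a i j hab hij, hx.comm b a i j hab hij]
    module
  · simp only [hab.ne', hab, lt_irrefl, if_true, if_false, one_smul, zero_smul, add_zero]
    rw [hx.col i b a hab]
    module
  · simp only [hab.ne', hab, hij.ne', hij, if_true, if_false, one_smul]
    rw [hx.comm b a j i hab hij]

theorem BraidingRelation.isQuantumMatrix {q : K} (hq : q ≠ 0) {x : Matrix ι ι A}
    (hx : BraidingRelation q x) : IsQuantumMatrix q x where
  row k i j hij := by
    have h := hx k k i j
    simp only [hij.ne, hij.not_gt, lt_irrefl, if_true, if_false, one_smul, zero_smul,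
      add_zero] at h
    rw [← h, smul_smul, mul_inv_cancel₀ hq, one_smul]
  col k i j hij := by
    have h := hx i j k k
    simp only [hij.ne, hij.not_gt, lt_irrefl, if_true, if_false, one_smul, zero_smul,
      add_zero] at h
    rw [h, smul_smul, mul_inv_cancel₀ hq, one_smul]
  comm i k j m hik hjm := by
    have h := hx i k j m
    simpa only [hik.ne, hik.not_gt, hjm.ne, hjm.not_gt, if_false, one_smul, zero_smul,
      add_zero, eq_comm] using h
  cross i k j m hik hjm := by
    have h := hx i k m j
    simp only [hik.ne, hik.not_gt, hjm.ne', hjm, if_true, if_false, one_smul, zero_smul,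
      add_zero] at h
    rw [h]
    module

variable [Fintype ι]

theorem mul_braiding_apply (q : K) (m : Matrix (ι × ι) (ι × ι) A) (p s : ι × ι) :
    (m * (braiding q).map (algebraMap K A) : Matrix _ _ A) p s
      = (if s.1 = s.2 then q⁻¹ else 1) • m p s.swap
        + (if s.2 < s.1 then q⁻¹ - q else 0) • m p s := by
  simp only [Matrix.mul_apply, Matrix.map_apply, ← Algebra.commutes, ← Algebra.smul_def]
  simp only [braiding, add_smul, Finset.sum_add_distrib, ite_and, ite_smul, zero_smul,
    Finset.sum_ite_eq', Finset.mem_univ, if_true, Prod.fst_swap, Prod.snd_swap,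
    eq_comm (a := s.2)]

theorem braiding_mul_apply (q : K) (m : Matrix (ι × ι) (ι × ι) A) (p s : ι × ι) :
    ((braiding q).map (algebraMap K A) * m : Matrix _ _ A) p s
      = (if p.1 = p.2 then q⁻¹ else 1) • m p.swap s
        + (if p.2 < p.1 then q⁻¹ - q else 0) • m p s := by
  have hswap (t : ι × ι) : p = t.swap ↔ p.swap = t := by
    rw [eq_comm, Prod.swap_eq_iff_eq_swap, eq_comm]
  simp only [Matrix.mul_apply, Matrix.map_apply, ← Algebra.smul_def]
  simp only [braiding, add_smul, Finset.sum_add_distrib, ite_and, ite_smul, zero_smul, hswap,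
    Finset.sum_ite_eq, Finset.mem_univ, if_true]

theorem mul_kronecker_one (x y : Matrix ι ι A) :
    (x * y) ⊗ₖ (1 : Matrix ι ι A) = (x ⊗ₖ 1) * (y ⊗ₖ 1) := by
  simp only [Matrix.kronecker_one, Matrix.blockDiagonal_mul]

theorem one_kronecker_mul (x y : Matrix ι ι A) :
    (1 : Matrix ι ι A) ⊗ₖ (x * y) = (1 ⊗ₖ x) * (1 ⊗ₖ y) := by
  simp only [Matrix.one_kronecker, Matrix.blockDiagonal_mul, Matrix.reindex_apply,
    Matrix.submatrix_mul_equiv]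

theorem kronecker_one_mul_one_kronecker_apply (x y : Matrix ι ι A) (p s : ι × ι) :
    ((x ⊗ₖ 1) * (1 ⊗ₖ y) : Matrix _ _ A) p s = x p.1 s.1 * y p.2 s.2 := by
  simp [Matrix.mul_apply, Fintype.sum_prod_type, Matrix.one_apply]

theorem one_kronecker_mul_kronecker_one_apply (x y : Matrix ι ι A) (p s : ι × ι) :
    ((1 ⊗ₖ y) * (x ⊗ₖ 1) : Matrix _ _ A) p s = y p.2 s.2 * x p.1 s.1 := by
  simp [Matrix.mul_apply, Fintype.sum_prod_type, Matrix.one_apply]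

theorem isQuantumMatrix_iff_commute_braiding {q : K} (hq : q ≠ 0) {x : Matrix ι ι A} :
    IsQuantumMatrix q x ↔
      Commute ((braiding q).map (algebraMap K A)) ((x ⊗ₖ 1) * (1 ⊗ₖ x) : Matrix _ _ A) := by
  have hentries : BraidingRelation q x ↔
      Commute ((braiding q).map (algebraMap K A)) ((x ⊗ₖ 1) * (1 ⊗ₖ x) : Matrix _ _ A) := by
    rw [Commute, SemiconjBy, ← Matrix.ext_iff]
    simp only [mul_braiding_apply, braiding_mul_apply, kronecker_one_mul_one_kronecker_apply,
      Prod.forall, Prod.fst_swap, Prod.snd_swap, BraidingRelation]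
  exact ⟨fun hx => hentries.1 (hx.braidingRelation hq),
    fun hx => (hentries.2 hx).isQuantumMatrix hq⟩

theorem IsQuantumMatrix.commute_inverse {q : K} (hq : q ≠ 0) {x s : Matrix ι ι A}
    (hx : IsQuantumMatrix q x) (hxs : x * s = 1) (hsx : s * x = 1) :
    Commute ((braiding q).map (algebraMap K A)) ((1 ⊗ₖ s) * (s ⊗ₖ 1) : Matrix _ _ A) := by
  have hright : ((x ⊗ₖ 1) * (1 ⊗ₖ x) : Matrix _ _ A) * ((1 ⊗ₖ s) * (s ⊗ₖ 1)) = 1 := by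
    rw [mul_assoc, ← mul_assoc (1 ⊗ₖ x), ← one_kronecker_mul, hxs, Matrix.one_kronecker_one,
      one_mul, ← mul_kronecker_one, hxs, Matrix.one_kronecker_one]
  have hleft : ((1 ⊗ₖ s) * (s ⊗ₖ 1) : Matrix _ _ A) * ((x ⊗ₖ 1) * (1 ⊗ₖ x)) = 1 := by
    rw [mul_assoc, ← mul_assoc (s ⊗ₖ 1), ← mul_kronecker_one, hsx, Matrix.one_kronecker_one,
      one_mul, ← one_kronecker_mul, hsx, Matrix.one_kronecker_one]
  exact Commute.units_inv_right (u := ⟨_, _, hright, hleft⟩)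
    ((isQuantumMatrix_iff_commute_braiding hq).1 hx)

/-- The reflection `(i, j) ↦ (φ j, φ i)` fixes the braiding when `φ` reverses the order, and it
turns `s₂ s₁` into `y₁ y₂` for `y` the transpose of `s` reindexed by `φ`. -/
theorem IsQuantumMatrix.inverse {q : K} (hq : q ≠ 0) {x s : Matrix ι ι A}
    (hx : IsQuantumMatrix q x) (hxs : x * s = 1) (hsx : s * x = 1) {φ : ι → ι}
    (hφ : StrictAnti φ) : IsQuantumMatrix q (s.transpose.submatrix φ φ) := by
  refine BraidingRelation.isQuantumMatrix hq fun a b i j => ?_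
  have h := congrFun₂ (hx.commute_inverse hq hxs hsx).eq (φ j, φ i) (φ b, φ a)
  simp only [mul_braiding_apply, braiding_mul_apply, one_kronecker_mul_kronecker_one_apply,
    Prod.fst_swap, Prod.snd_swap, hφ.lt_iff_gt, hφ.injective.eq_iff] at h
  simpa only [Matrix.submatrix_apply, Matrix.transpose_apply, eq_comm (a := a),
    eq_comm (a := i)] using h.symm

theorem IsQuantumMatrix.exchange {q : K} (hq : q ≠ 0) {x s : Matrix ι ι A}
    (hx : IsQuantumMatrix q x) (hxs : x * s = 1) (hsx : s * x = 1) (i j k m : ι) :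
    ∑ p, ∑ b, braiding q (p, k) (b, m) • (s i p * x b j)
      = ∑ c, ∑ d, braiding q (i, c) (j, d) • (x k c * s d m) := by
  let R : Matrix (ι × ι) (ι × ι) A := (braiding q).map (algebraMap K A)
  have hcomm : R * ((x ⊗ₖ 1) * (1 ⊗ₖ x)) = ((x ⊗ₖ 1) * (1 ⊗ₖ x)) * R :=
    ((isQuantumMatrix_iff_commute_braiding hq).1 hx).eq
  have h : (s ⊗ₖ 1) * R * (x ⊗ₖ 1) = (1 ⊗ₖ x) * R * (1 ⊗ₖ s) := calc
    (s ⊗ₖ 1) * R * (x ⊗ₖ 1)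
      = (s ⊗ₖ 1) * (R * ((x ⊗ₖ 1) * (1 ⊗ₖ x))) * (1 ⊗ₖ s) := by
        simp only [mul_assoc, ← one_kronecker_mul, hxs, Matrix.one_kronecker_one, mul_one]
    _ = ((s * x) ⊗ₖ 1) * (1 ⊗ₖ x) * R * (1 ⊗ₖ s) := by
        rw [hcomm, mul_kronecker_one]
        simp only [mul_assoc]
    _ = (1 ⊗ₖ x) * R * (1 ⊗ₖ s) := by rw [hsx, Matrix.one_kronecker_one, one_mul]
  rw [Finset.sum_comm]
  conv_rhs => rw [Finset.sum_comm]
  simpa [R, Matrix.mul_apply, Fintype.sum_prod_type, Matrix.one_apply, Finset.sum_mul,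
    Algebra.smul_def, Algebra.commutes, mul_assoc] using congrFun₂ h (i, k) (j, m)

end QuantumMatrix

/-! ### Quantum exterior algebras -/

section Exterior

open Finset

/-- The number of inversions of a word. -/
def invCount {ι : Type*} [LT ι] [DecidableLT ι] {r : ℕ} (a : Fin r → ι) : ℕ :=
  #{p : Fin r × Fin r | p.1 < p.2 ∧ a p.2 < a p.1}

theorem invCount_succ {ι : Type*} [LT ι] [DecidableLT ι] {r : ℕ} (a : Fin (r + 1) → ι) :
    invCount a = #{k : Fin r | a k.succ < a 0} + invCount fun k : Fin r => a k.succ := by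
  simp only [invCount, card_filter, Fintype.sum_prod_type]
  simp only [Fin.sum_univ_succ, Fin.succ_lt_succ_iff, Fin.succ_pos, true_and, Fin.not_lt_zero,
    false_and, if_false, zero_add]

theorem permLength_symm {r : ℕ} (s : Equiv.Perm (Fin r)) : permLength s.symm = permLength s :=
  card_bijective (fun p => (s.symm p.2, s.symm p.1))
    (((Equiv.prodComm _ _).trans (Equiv.prodCongr s.symm s.symm)).bijective) (by simp [and_comm])

theorem prod_ofFn_sum_tmul {ι K A B : Type*} [Fintype ι] [CommSemiring K] [Semiring A] [Algebra K A]
    [Semiring B] [Algebra K B] (e : ι → B) (x : Matrix ι ι A) {r : ℕ} (b : Fin r → ι) :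
    (List.ofFn fun k => ∑ i, e i ⊗ₜ[K] x i (b k)).prod
      = ∑ a : Fin r → ι, (List.ofFn fun k => e (a k)).prod ⊗ₜ[K]
          (List.ofFn fun k => x (a k) (b k)).prod := by
  induction r with
  | zero => simp [Algebra.TensorProduct.one_def]
  | succ r ih =>
    rw [List.ofFn_succ, List.prod_cons, ih, ← (Fin.consEquiv fun _ => ι).sum_comp,
      Fintype.sum_prod_type, sum_mul_sum]
    simp [List.ofFn_succ, Fin.consEquiv]

variable {ι K A B : Type*} [LinearOrder ι] [Field K] [Ring A] [Algebra K A] [Ring B] [Algebra K B]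

/-- The product of the `e i`, `i ∈ I`, in increasing order. -/
def extProd {M : Type*} [Monoid M] (e : ι → M) (I : Finset ι) : M :=
  ((I.sort (· ≤ ·)).map e).prod

@[simp]
theorem extProd_empty {M : Type*} [Monoid M] (e : ι → M) : extProd e ∅ = 1 := by
  simp [extProd]

theorem extProd_insert_of_forall_lt {M : Type*} [Monoid M] (e : ι → M) {I : Finset ι} {i : ι}
    (hi : ∀ j ∈ I, i < j) : extProd e (insert i I) = e i * extProd e I := by
  rw [extProd, sort_insert (· ≤ ·) (fun j hj => (hi j hj).le) fun h => (hi i h).false]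
  rfl

/-- The relations of the generators of a quantum exterior algebra. Both `Λ_q(V)` and, with the
order of the indices reversed, `Λ_q(V^*)` are presented by them. -/
structure IsExterior (q : K) (e : ι → B) : Prop where
  sq : ∀ i, e i * e i = 0
  swap : ∀ i j, i < j → e j * e i = (-q) • (e i * e j)

variable {q : K} {e : ι → B}

theorem IsExterior.mul_extProd (he : IsExterior q e) {I : Finset ι} {x : ι} (hx : x ∉ I) :
    e x * extProd e I = (-q) ^ #{i ∈ I | i < x} • extProd e (insert x I) := by
  induction I using Finset.induction_on_min with
  | empty => simp [extProd]
  | insert m I hm ih =>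
    rw [mem_insert, not_or] at hx
    rcases lt_or_gt_of_ne hx.1 with hxm | hmx
    · have hlt : ∀ j ∈ insert m I, x < j := by
        simpa [hxm] using fun j hj => hxm.trans (hm j hj)
      rw [filter_false_of_mem fun j hj => (hlt j hj).not_gt, card_empty, pow_zero, one_smul,
        extProd_insert_of_forall_lt e hlt]
    · have hlt : ∀ j ∈ insert x I, m < j := by simpa [hmx] using hm
      rw [extProd_insert_of_forall_lt e hm, ← mul_assoc, he.swap m x hmx, smul_mul_assoc, mul_assoc,
        ih hx.2, mul_smul_comm, smul_smul, ← pow_succ', filter_insert, if_pos hmx,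
        card_insert_of_notMem fun h => (hm m (mem_of_mem_filter m h)).false, insert_comm,
        extProd_insert_of_forall_lt e hlt]

theorem IsExterior.extProd_mul (he : IsExterior q e) {I : Finset ι} {x : ι} (hx : x ∉ I) :
    extProd e I * e x = (-q) ^ #{i ∈ I | x < i} • extProd e (insert x I) := by
  induction I using Finset.induction_on_min with
  | empty => simp [extProd]
  | insert m I hm ih =>
    rw [mem_insert, not_or] at hx
    rw [extProd_insert_of_forall_lt e hm, mul_assoc, ih hx.2, mul_smul_comm, filter_insert]
    rcases lt_or_gt_of_ne hx.1 with hxm | hmx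
    · have hxI : ∀ j ∈ I, x < j := fun j hj => hxm.trans (hm j hj)
      have hlt : ∀ j ∈ insert m I, x < j := by simpa [hxm] using hxI
      rw [if_pos hxm, card_insert_of_notMem fun h => (hm m (mem_of_mem_filter m h)).false,
        extProd_insert_of_forall_lt e hxI, extProd_insert_of_forall_lt e hlt,
        extProd_insert_of_forall_lt e hm, ← mul_assoc, he.swap x m hxm, smul_mul_assoc, smul_smul,
        ← pow_succ, mul_assoc]
    · have hlt : ∀ j ∈ insert x I, m < j := by simpa [hmx] using hm
      rw [if_neg hmx.not_gt, insert_comm, extProd_insert_of_forall_lt e hlt]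

theorem IsExterior.mul_extProd_of_mem (he : IsExterior q e) (hq : q ≠ 0) {I : Finset ι} {x : ι}
    (hx : x ∈ I) : e x * extProd e I = 0 := by
  have h := congrArg (e x * ·) (he.mul_extProd (notMem_erase x I))
  simp only [← mul_assoc, he.sq, zero_mul, mul_smul_comm, insert_erase hx] at h
  exact (smul_eq_zero.1 h.symm).resolve_left (pow_ne_zero _ (neg_ne_zero.2 hq))

theorem IsExterior.extProd_mul_of_mem (he : IsExterior q e) (hq : q ≠ 0) {I : Finset ι} {x : ι}
    (hx : x ∈ I) : extProd e I * e x = 0 := by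
  have h := congrArg (· * e x) (he.extProd_mul (notMem_erase x I))
  simp only [mul_assoc, he.sq, mul_zero, smul_mul_assoc, insert_erase hx] at h
  exact (smul_eq_zero.1 h.symm).resolve_left (pow_ne_zero _ (neg_ne_zero.2 hq))

theorem IsExterior.word_eq (he : IsExterior q e) {r : ℕ} {a : Fin r → ι}
    (ha : Function.Injective a) :
    (List.ofFn fun k => e (a k)).prod = (-q) ^ invCount a • extProd e (univ.image a) := by
  induction r with
  | zero => simp [invCount]
  | succ r ih =>
    have htail : Function.Injective fun k : Fin r => a k.succ := ha.comp (Fin.succ_injective r)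
    have hhead : a 0 ∉ univ.image fun k : Fin r => a k.succ := by
      simp [ha.eq_iff]
    have himage : insert (a 0) (univ.image fun k : Fin r => a k.succ) = univ.image a := by
      ext i
      simp [Fin.exists_fin_succ, eq_comm]
    rw [List.ofFn_succ, List.prod_cons, ih htail, mul_smul_comm, he.mul_extProd hhead, smul_smul,
      invCount_succ, ← pow_add, add_comm, filter_image, card_image_of_injective _ htail, himage]

theorem IsExterior.word_eq_zero (he : IsExterior q e) (hq : q ≠ 0) {r : ℕ} {a : Fin r → ι}
    (ha : ¬ Function.Injective a) : (List.ofFn fun k => e (a k)).prod = 0 := by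
  induction r with
  | zero => exact absurd (Function.injective_of_subsingleton a) ha
  | succ r ih =>
    rw [List.ofFn_succ, List.prod_cons]
    by_cases htail : Function.Injective fun k : Fin r => a k.succ
    · have hhead : a 0 ∈ univ.image fun k : Fin r => a k.succ := by
        by_contra h
        refine ha ?_
        rw [← Fin.cons_self_tail a, Fin.cons_injective_iff]
        exact ⟨by simpa [Fin.tail] using h, htail⟩
      rw [he.word_eq htail, mul_smul_comm, he.mul_extProd_of_mem hq hhead, smul_zero]
    · rw [ih htail, mul_zero]

theorem sum_sum_eq_sum_lt [Fintype ι] {M : Type*} [AddCommMonoid M] (F : ι → ι → M)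
    (hF : ∀ i, F i i = 0) :
    ∑ i, ∑ j, F i j = ∑ i, ∑ j, if i < j then F i j + F j i else 0 := by
  have hsplit (i j : ι) : F i j = (if i < j then F i j else 0) + if j < i then F i j else 0 := by
    rcases lt_trichotomy i j with h | rfl | h
    · simp [h, h.not_gt]
    · simp [hF]
    · simp [h, h.not_gt]
  simp_rw [ite_add_zero, sum_add_distrib]
  rw [sum_congr rfl fun i _ => sum_congr rfl fun j _ => hsplit i j]
  simp_rw [sum_add_distrib]
  rw [sum_comm (f := fun i j => if j < i then F i j else 0)]

theorem IsExterior.tensor [Fintype ι] (hq : q ≠ 0) (he : IsExterior q e) {x : Matrix ι ι A}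
    (hx : IsQuantumMatrix q x) : IsExterior q fun j => ∑ i, e i ⊗ₜ[K] x i j := by
  have hmul (i j : ι) : (∑ a, e a ⊗ₜ[K] x a i) * (∑ b, e b ⊗ₜ[K] x b j) =
      ∑ a, ∑ b, if a < b then (e a * e b) ⊗ₜ[K] (x a i * x b j - q • (x b i * x a j)) else 0 := by
    simp_rw [sum_mul_sum, Algebra.TensorProduct.tmul_mul_tmul]
    rw [sum_sum_eq_sum_lt _ fun a => by rw [he.sq, TensorProduct.zero_tmul]]
    refine sum_congr rfl fun a _ => sum_congr rfl fun b _ => if_ctx_congr Iff.rfl (fun h => ?_)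
      fun _ => rfl
    rw [he.swap a b h, TensorProduct.smul_tmul, ← TensorProduct.tmul_add, neg_smul, sub_eq_add_neg]
  constructor
  · intro i
    rw [hmul]
    refine sum_eq_zero fun a _ => sum_eq_zero fun b _ => ?_
    split_ifs with h
    · rw [hx.col i a b h, sub_self, TensorProduct.tmul_zero]
    · rfl
  · intro i j hij
    simp_rw [hmul, smul_sum, smul_ite, smul_zero, ← TensorProduct.tmul_smul]
    refine sum_congr rfl fun a _ => sum_congr rfl fun b _ => if_ctx_congr Iff.rfl (fun h => ?_)
      fun _ => rfl
    rw [hx.cross a b i j h hij, hx.comm a b i j h hij]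
    congr 1
    match_scalars <;> field_simp
    ring

/-- Left multiplication by `v_i` in terms of the basis `(v_I)` of `Λ_q(V)`, as an operator on the
space spanned by the symbols `I`. It is the model that shows `v_{1} ∧ ⋯ ∧ v_{n} ≠ 0`. -/
noncomputable def wedgeOp (q : K) (i : ι) : Module.End K (Finset ι →₀ K) :=
  Finsupp.linearCombination K fun I =>
    if i ∈ I then 0 else Finsupp.single (insert i I) ((-q) ^ #{j ∈ I | j < i})

theorem wedgeOp_single (q : K) (i : ι) (I : Finset ι) (c : K) :
    wedgeOp q i (Finsupp.single I c) =
      if i ∈ I then 0 else Finsupp.single (insert i I) (c * (-q) ^ #{j ∈ I | j < i}) := by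
  simp only [wedgeOp, Finsupp.linearCombination_single]
  split_ifs <;> simp

theorem isExterior_wedgeOp (q : K) : IsExterior q (wedgeOp q : ι → _) := by
  constructor
  · intro i
    refine Finsupp.lhom_ext fun I c => ?_
    rw [Module.End.mul_apply, wedgeOp_single]
    split_ifs <;> simp only [map_zero, wedgeOp_single, mem_insert_self, if_true,
      LinearMap.zero_apply]
  · intro i j hij
    refine Finsupp.lhom_ext fun I c => ?_
    rw [LinearMap.smul_apply, Module.End.mul_apply, Module.End.mul_apply, wedgeOp_single,
      wedgeOp_single]
    by_cases hi : i ∈ I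
    · by_cases hj : j ∈ I <;> simp only [hi, hj, if_true, if_false, map_zero, wedgeOp_single,
        mem_insert, or_true, smul_zero]
    by_cases hj : j ∈ I
    · simp only [hi, hj, if_true, if_false, map_zero, wedgeOp_single, mem_insert, or_true,
        smul_zero]
    simp only [hi, hj, if_false, wedgeOp_single, mem_insert, hij.ne', hij.ne, false_or,
      Finsupp.smul_single]
    rw [insert_comm, filter_insert, if_pos hij, filter_insert, if_neg hij.not_gt,
      card_insert_of_notMem (by simp [hi])]
    congr 1
    rw [smul_eq_mul]
    ring

theorem extProd_wedgeOp (q : K) (I : Finset ι) :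
    extProd (wedgeOp q) I (Finsupp.single ∅ 1) = Finsupp.single I 1 := by
  induction I using Finset.induction_on_min with
  | empty => simp
  | insert m I hm ih =>
    rw [extProd_insert_of_forall_lt _ hm, Module.End.mul_apply, ih, wedgeOp_single,
      if_neg fun h => (hm m h).false, filter_false_of_mem fun j hj => (hm j hj).not_gt]
    simp

theorem extProd_wedgeOp_tmul_injective (q : K) (I : Finset ι) :
    Function.Injective fun a : A => extProd (wedgeOp q) I ⊗ₜ[K] a := by
  intro a b h
  have h' := congrArg (TensorProduct.lid K A ∘ LinearMap.rTensor A
    (Finsupp.lapply I ∘ₗ LinearMap.applyₗ (Finsupp.single ∅ 1))) h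
  simpa [extProd_wedgeOp] using h'

end Exterior

/-! ### Laplace expansion and the antipode -/

section Laplace

open Finset

theorem sum_eq_sum_orderEmbedding_perm {ι M : Type*} [Fintype ι] [LinearOrder ι] [AddCommMonoid M]
    {r : ℕ} (f : (Fin r → ι) → M) (hf : ∀ a, ¬ Function.Injective a → f a = 0) :
    ∑ a, f a = ∑ c : Fin r ↪o ι, ∑ s : Equiv.Perm (Fin r), f (c ∘ s) := by
  rw [← Fintype.sum_prod_type' fun (c : Fin r ↪o ι) (s : Equiv.Perm (Fin r)) => f (c ∘ s)]
  symm
  refine sum_of_injOn (fun p => p.1 ∘ p.2) ?_ (by simp) (fun a _ ha => hf a fun hinj => ha ?_)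
    (by simp)
  · rintro ⟨c, s⟩ - ⟨c', s'⟩ - h
    have hrange : Set.range c = Set.range c' := by
      rw [← s.surjective.range_comp c, ← s'.surjective.range_comp c']
      exact congrArg Set.range h
    obtain rfl := OrderEmbedding.range_inj.1 hrange
    exact Prod.ext rfl (Equiv.ext fun k => c.injective (congrFun h k))
  · have hmono : StrictMono (a ∘ Tuple.sort a) :=
      (Tuple.monotone_sort a).strictMono_of_injective (hinj.comp (Tuple.sort a).injective)
    exact ⟨(OrderEmbedding.ofStrictMono _ hmono, (Tuple.sort a)⁻¹), by simp, by ext; simp⟩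

variable {n : ℕ} {q : ℝ} {A B : Type*} [Ring A] [Algebra ℂ A] [Ring B] [Algebra ℂ B]

theorem invCount_comp_perm {r : ℕ} (c : Fin r ↪o Fin n) (s : Equiv.Perm (Fin r)) :
    invCount (c ∘ s) = permLength s := by
  simp [invCount, permLength]

theorem IsExterior.word_orderEmbedding {e : Fin n → B} (he : IsExterior (q : ℂ) e) {r : ℕ}
    (c : Fin r ↪o Fin n) : (List.ofFn fun k => e (c k)).prod = extProd e (univ.image c) := by
  have hlength : invCount c = 0 := by
    simp only [invCount, c.lt_iff_lt, card_eq_zero, filter_eq_empty_iff]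
    exact fun p _ h => lt_asymm h.1 h.2
  rw [he.word_eq c.injective, hlength, pow_zero, one_smul]

theorem image_complEmb (i : Fin n) : univ.image (complEmb i) = {i}ᶜ := by
  simp [complEmb]

theorem notMem_image_iff_eq_complEmb {i : Fin n} {c : Fin (n - 1) ↪o Fin n} :
    i ∉ univ.image c ↔ c = complEmb i := by
  refine ⟨fun hi => ?_, fun h => by simp [h, image_complEmb]⟩
  have himage : univ.image c = {i}ᶜ :=
    eq_of_subset_of_card_le (by simpa [subset_compl_singleton] using hi)
      (by simp [card_image_of_injective _ c.injective, card_compl])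
  refine OrderEmbedding.range_inj.1 ?_
  rw [← Set.image_univ, ← Set.image_univ, ← coe_univ, ← coe_image, ← coe_image, himage,
    image_complEmb]

theorem card_compl_filter_lt (i : Fin n) : #{j ∈ ({i}ᶜ : Finset (Fin n)) | j < i} = i := by
  rw [← Fin.card_Iio]
  congr 1
  ext j
  simpa using fun h : j < i => h.ne

theorem card_compl_filter_gt (i : Fin n) : #{j ∈ ({i}ᶜ : Finset (Fin n)) | i < j} = n - 1 - i := by
  rw [← Fin.card_Ioi]
  congr 1
  ext j
  simpa using fun h : i < j => h.ne'

theorem IsExterior.mul_extProd_compl (hq : q ≠ 0) {e : Fin n → B} (he : IsExterior (q : ℂ) e)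
    (i k : Fin n) : e i * extProd e {k}ᶜ
      = if i = k then (-(q : ℂ)) ^ (k : ℕ) • extProd e univ else 0 := by
  split_ifs with hik
  · subst hik
    rw [he.mul_extProd (by simp), card_compl_filter_lt, insert_compl_self]
  · exact he.mul_extProd_of_mem (by exact_mod_cast hq) (by simpa using hik)

theorem IsExterior.extProd_compl_mul (hq : q ≠ 0) {e : Fin n → B} (he : IsExterior (q : ℂ) e)
    (i k : Fin n) : extProd e {k}ᶜ * e i
      = if i = k then (-(q : ℂ)) ^ (n - 1 - k) • extProd e univ else 0 := by
  split_ifs with hik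
  · subst hik
    rw [he.extProd_mul (by simp), card_compl_filter_gt, insert_compl_self]
  · exact he.extProd_mul_of_mem (by exact_mod_cast hq) (by simpa using hik)

theorem prod_orderedInsert_of_commute {ι : Type*} {r : ι → ι → Prop} [DecidableRel r]
    {M : Type*} [Monoid M] (f : ι → M) (x : ι) (l : List ι)
    (h : ∀ y ∈ l, ¬ r x y → Commute (f x) (f y)) :
    ((l.orderedInsert r x).map f).prod = f x * (l.map f).prod := by
  induction l with
  | nil => simp
  | cons y l ih =>
    rw [List.orderedInsert]
    split_ifs with hr
    · simp
    · rw [List.map_cons, List.prod_cons, ih fun z hz => h z (by simp [hz]), List.map_cons,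
        List.prod_cons, ← mul_assoc, ← mul_assoc, (h y (by simp) hr).eq]

theorem prod_insertionSort_of_commute {ι : Type*} {r : ι → ι → Prop} [DecidableRel r]
    {M : Type*} [Monoid M] (f : ι → M) (l : List ι)
    (h : l.Pairwise fun x y => ¬ r x y → Commute (f x) (f y)) :
    ((l.insertionSort r).map f).prod = (l.map f).prod := by
  induction l with
  | nil => simp
  | cons x l ih =>
    rw [List.pairwise_cons] at h
    rw [List.insertionSort_cons, prod_orderedInsert_of_commute, ih h.2, List.map_cons,
      List.prod_cons]
    exact fun y hy => h.1 y ((List.perm_insertionSort r l).mem_iff.mp hy)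

theorem insertionSort_ofFn_perm {r : ℕ} (s : Equiv.Perm (Fin r)) :
    (List.ofFn fun k => (s k, k)).insertionSort (fun p p' => p.1 ≤ p'.1)
      = List.ofFn fun k => (k, s.symm k) := by
  refine List.Perm.eq_of_pairwise (le := fun p p' => p.1 ≤ p'.1) ?_
    (List.pairwise_insertionSort _ _) (List.pairwise_ofFn.2 fun _ _ h => h.le) ?_
  · intro p p' hp hp' h h'
    rw [(List.perm_insertionSort _ _).mem_iff, List.mem_ofFn] at hp
    rw [List.mem_ofFn] at hp'
    obtain ⟨k, rfl⟩ := hp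
    obtain ⟨k', rfl⟩ := hp'
    have hk : s k = k' := le_antisymm h h'
    simp [← hk]
  · refine (List.perm_insertionSort _ _).trans ?_
    simpa [Function.comp_def] using Equiv.Perm.ofFn_comp_perm s fun k => (k, s.symm k)

/-- Two factors that trade places stand in a row and a column that are both in the wrong order,
and such entries of a quantum matrix commute. -/
theorem IsQuantumMatrix.prod_reorder {q : ℂ} {x : Matrix (Fin n) (Fin n) A}
    (hx : IsQuantumMatrix q x) {r : ℕ} (a b : Fin r ↪o Fin n) (s : Equiv.Perm (Fin r)) :
    (List.ofFn fun k => x (a (s k)) (b k)).prod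
      = (List.ofFn fun k => x (a k) (b (s.symm k))).prod := by
  have h := prod_insertionSort_of_commute (r := fun p p' : Fin r × Fin r => p.1 ≤ p'.1)
    (fun p => x (a p.1) (b p.2)) (List.ofFn fun k => (s k, k)) <| List.pairwise_ofFn.2
      fun k k' hk hs => (hx.comm _ _ _ _ (a.strictMono (not_le.1 hs)) (b.strictMono hk)).symm
  rw [insertionSort_ofFn_perm] at h
  simpa [List.map_ofFn, Function.comp_def] using h.symm

theorem IsQuantumMatrix.qMinor_eq_sum_row_perm {x : Matrix (Fin n) (Fin n) A}
    (hx : IsQuantumMatrix (q : ℂ) x) {r : ℕ} (a b : Fin r ↪o Fin n) :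
    qMinor q x a b = ∑ s : Equiv.Perm (Fin r),
      (-(q : ℂ)) ^ permLength s • (List.ofFn fun k => x (a (s k)) (b k)).prod := by
  unfold qMinor
  rw [← Equiv.sum_comp (Equiv.inv (Equiv.Perm (Fin r)))]
  refine sum_congr rfl fun s _ => ?_
  rw [hx.prod_reorder, Equiv.inv_apply, ← permLength_symm]
  rfl

theorem IsQuantumMatrix.qMinor_transpose {x : Matrix (Fin n) (Fin n) A}
    (hx : IsQuantumMatrix (q : ℂ) x) {r : ℕ} (a b : Fin r ↪o Fin n) :
    qMinor q x.transpose b a = qMinor q x a b :=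
  (hx.qMinor_eq_sum_row_perm a b).symm

theorem IsQuantumMatrix.qDet_transpose {x : Matrix (Fin n) (Fin n) A}
    (hx : IsQuantumMatrix (q : ℂ) x) : qDet q x.transpose = qDet q x :=
  hx.qMinor_transpose _ _

theorem IsExterior.word_tensor_eq_sum_qMinor (hq : q ≠ 0) {e : Fin n → B}
    (he : IsExterior (q : ℂ) e) {x : Matrix (Fin n) (Fin n) A} (hx : IsQuantumMatrix (q : ℂ) x)
    {r : ℕ} (b : Fin r ↪o Fin n) : (List.ofFn fun k => ∑ i, e i ⊗ₜ[ℂ] x i (b k)).prod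
      = ∑ c : Fin r ↪o Fin n, extProd e (univ.image c) ⊗ₜ[ℂ] qMinor q x c b := by
  have hq' : (q : ℂ) ≠ 0 := by exact_mod_cast hq
  rw [prod_ofFn_sum_tmul, sum_eq_sum_orderEmbedding_perm _ fun a ha => by
    rw [he.word_eq_zero hq' ha, TensorProduct.zero_tmul]]
  refine sum_congr rfl fun c _ => ?_
  rw [hx.qMinor_eq_sum_row_perm, TensorProduct.tmul_sum]
  refine sum_congr rfl fun s _ => ?_
  rw [he.word_eq (c.injective.comp s.injective), invCount_comp_perm, TensorProduct.smul_tmul,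
    ← image_image, image_univ_equiv]
  rfl

theorem IsExterior.extProd_univ_tensor (hq : q ≠ 0) {e : Fin n → B}
    (he : IsExterior (q : ℂ) e) {x : Matrix (Fin n) (Fin n) A} (hx : IsQuantumMatrix (q : ℂ) x) :
    extProd (fun j => ∑ i, e i ⊗ₜ[ℂ] x i j) univ = extProd e univ ⊗ₜ[ℂ] qDet q x := by
  have hE := he.tensor (by exact_mod_cast hq) hx
  let id : Fin n ↪o Fin n := (OrderIso.refl (Fin n)).toOrderEmbedding
  have himage : univ.image id = univ := image_univ_of_surjective (OrderIso.refl (Fin n)).surjective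
  have hunique (c : Fin n ↪o Fin n) : c = id :=
    OrderEmbedding.range_inj.1 <|
      (Finite.surjective_of_injective c.injective).range_eq.trans
        (OrderIso.refl (Fin n)).surjective.range_eq.symm
  have h := hE.word_orderEmbedding id
  rw [he.word_tensor_eq_sum_qMinor hq hx,
    Fintype.sum_eq_single id fun c hc => absurd (hunique c) hc, himage] at h
  exact h.symm

theorem IsExterior.mul_word_complEmb (hq : q ≠ 0) {e : Fin n → B} (he : IsExterior (q : ℂ) e)
    {x : Matrix (Fin n) (Fin n) A} (hx : IsQuantumMatrix (q : ℂ) x) (i k : Fin n) :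
    (∑ j, e j ⊗ₜ[ℂ] x j i) * (List.ofFn fun m => ∑ j, e j ⊗ₜ[ℂ] x j (complEmb k m)).prod
      = extProd e univ ⊗ₜ[ℂ]
        ∑ j : Fin n, (-(q : ℂ)) ^ (j : ℕ) • (x j i * qMinor q x (complEmb j) (complEmb k)) := by
  rw [he.word_tensor_eq_sum_qMinor hq hx, sum_mul_sum, TensorProduct.tmul_sum]
  refine sum_congr rfl fun j _ => ?_
  simp_rw [Algebra.TensorProduct.tmul_mul_tmul]
  rw [Fintype.sum_eq_single (complEmb j) fun c hc => by
    rw [he.mul_extProd_of_mem (by exact_mod_cast hq)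
      (not_not.1 (notMem_image_iff_eq_complEmb.not.2 hc)), TensorProduct.zero_tmul]]
  rw [image_complEmb, he.mul_extProd_compl hq, if_pos rfl, TensorProduct.smul_tmul]

theorem IsExterior.word_complEmb_mul (hq : q ≠ 0) {e : Fin n → B} (he : IsExterior (q : ℂ) e)
    {x : Matrix (Fin n) (Fin n) A} (hx : IsQuantumMatrix (q : ℂ) x) (i k : Fin n) :
    (List.ofFn fun m => ∑ j, e j ⊗ₜ[ℂ] x j (complEmb k m)).prod * (∑ j, e j ⊗ₜ[ℂ] x j i)
      = extProd e univ ⊗ₜ[ℂ]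
        ∑ j : Fin n, (-(q : ℂ)) ^ (n - 1 - j) • (qMinor q x (complEmb j) (complEmb k) * x j i) := by
  rw [he.word_tensor_eq_sum_qMinor hq hx, mul_sum, TensorProduct.tmul_sum]
  refine sum_congr rfl fun j _ => ?_
  simp_rw [sum_mul, Algebra.TensorProduct.tmul_mul_tmul]
  rw [Fintype.sum_eq_single (complEmb j) fun c hc => by
    rw [he.extProd_mul_of_mem (by exact_mod_cast hq)
      (not_not.1 (notMem_image_iff_eq_complEmb.not.2 hc)), TensorProduct.zero_tmul]]
  rw [image_complEmb, he.extProd_compl_mul hq, if_pos rfl, TensorProduct.smul_tmul]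

theorem IsQuantumMatrix.laplace_left (hq : q ≠ 0) {x : Matrix (Fin n) (Fin n) A}
    (hx : IsQuantumMatrix (q : ℂ) x) (i k : Fin n) :
    ∑ j : Fin n, (-(q : ℂ)) ^ (j : ℕ) • (x j i * qMinor q x (complEmb j) (complEmb k))
      = if i = k then (-(q : ℂ)) ^ (k : ℕ) • qDet q x else 0 := by
  have he := isExterior_wedgeOp (ι := Fin n) (q : ℂ)
  have hE := he.tensor (by exact_mod_cast hq) hx
  apply extProd_wedgeOp_tmul_injective (q : ℂ) (univ : Finset (Fin n))
  dsimp only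
  rw [← he.mul_word_complEmb hq hx, hE.word_orderEmbedding, image_complEmb,
    hE.mul_extProd_compl hq, he.extProd_univ_tensor hq hx]
  split_ifs
  · rw [TensorProduct.tmul_smul]
  · rw [TensorProduct.tmul_zero]

theorem IsQuantumMatrix.laplace_right (hq : q ≠ 0) {x : Matrix (Fin n) (Fin n) A}
    (hx : IsQuantumMatrix (q : ℂ) x) (i k : Fin n) :
    ∑ j : Fin n, (-(q : ℂ)) ^ (n - 1 - j) • (qMinor q x (complEmb j) (complEmb k) * x j i)
      = if i = k then (-(q : ℂ)) ^ (n - 1 - k) • qDet q x else 0 := by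
  have he := isExterior_wedgeOp (ι := Fin n) (q : ℂ)
  have hE := he.tensor (by exact_mod_cast hq) hx
  apply extProd_wedgeOp_tmul_injective (q : ℂ) (univ : Finset (Fin n))
  dsimp only
  rw [← he.word_complEmb_mul hq hx, hE.word_orderEmbedding, image_complEmb,
    hE.extProd_compl_mul hq, he.extProd_univ_tensor hq hx]
  split_ifs
  · rw [TensorProduct.tmul_smul]
  · rw [TensorProduct.tmul_zero]

/-- The quantum adjugate, the matrix of complementary minors whose product with the quantum matrix
`x`, in either order, is the scalar matrix `det_q`. -/
noncomputable def qAdjugate (q : ℝ) (x : Matrix (Fin n) (Fin n) A) : Matrix (Fin n) (Fin n) A :=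
  .of fun i j => (-(q : ℂ)) ^ ((i : ℤ) - (j : ℤ)) • qMinor q x (complEmb j) (complEmb i)

theorem IsQuantumMatrix.mul_qAdjugate (hq : q ≠ 0) {x : Matrix (Fin n) (Fin n) A}
    (hx : IsQuantumMatrix (q : ℂ) x) : x * qAdjugate q x = .diagonal fun _ => qDet q x := by
  have hq' : -(q : ℂ) ≠ 0 := neg_ne_zero.2 (by exact_mod_cast hq)
  ext i k
  have h := congrArg ((-(q : ℂ)) ^ (-(k : ℤ)) • ·) (hx.transpose.laplace_left hq i k)
  simp only [smul_sum, smul_smul, smul_ite, smul_zero, ← zpow_natCast, ← zpow_add₀ hq',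
    hx.qMinor_transpose, neg_add_cancel, zpow_zero, one_smul, Matrix.transpose_apply] at h
  rw [Matrix.diagonal_apply, Matrix.mul_apply, ← hx.qDet_transpose, ← h]
  simp only [qAdjugate, Matrix.of_apply, mul_smul_comm, neg_add_eq_sub]

theorem IsQuantumMatrix.qAdjugate_mul (hq : q ≠ 0) {x : Matrix (Fin n) (Fin n) A}
    (hx : IsQuantumMatrix (q : ℂ) x) : qAdjugate q x * x = .diagonal fun _ => qDet q x := by
  have hq' : -(q : ℂ) ≠ 0 := neg_ne_zero.2 (by exact_mod_cast hq)
  have hexp (j : Fin n) : ((n - 1 - j : ℕ) : ℤ) = (n - 1 : ℕ) - (j : ℤ) := by omega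
  ext i k
  have h := congrArg ((-(q : ℂ)) ^ ((i : ℤ) - (n - 1 : ℕ)) • ·) (hx.laplace_right hq k i)
  simp only [smul_sum, smul_smul, smul_ite, smul_zero, ← zpow_natCast, ← zpow_add₀ hq', hexp,
    sub_add_sub_cancel, sub_self, zpow_zero, one_smul, eq_comm (a := k)] at h
  rw [Matrix.diagonal_apply, Matrix.mul_apply, ← h]
  simp only [qAdjugate, Matrix.of_apply, smul_mul_assoc]

theorem IsQuantumMatrix.commute_qDet (hq : q ≠ 0) {x : Matrix (Fin n) (Fin n) A}
    (hx : IsQuantumMatrix (q : ℂ) x) (i j : Fin n) : Commute (qDet q x) (x i j) := by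
  have h := mul_assoc x (qAdjugate q x) x
  rw [hx.mul_qAdjugate hq, hx.qAdjugate_mul hq] at h
  have hij := congrFun₂ h i j
  rw [Matrix.diagonal_mul, Matrix.mul_diagonal] at hij
  exact hij

end Laplace

section Antipode

variable {n : ℕ} {q : ℝ}

theorem isQuantumMatrix_t : IsQuantumMatrix (q : ℂ) (.of (t q : Fin n → Fin n → Aq n q)) where
  row k i j hij := by
    have h := RingQuot.mkAlgHom_rel ℂ (AqRel.row (q := q) k i j hij)
    rwa [map_smul, map_mul, map_mul] at h
  col k i j hij := by
    have h := RingQuot.mkAlgHom_rel ℂ (AqRel.col (q := q) k i j hij)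
    rwa [map_smul, map_mul, map_mul] at h
  comm i k j m hik hjm := by
    have h := RingQuot.mkAlgHom_rel ℂ (AqRel.comm (q := q) i k j m hik hjm)
    rwa [map_mul, map_mul] at h
  cross i k j m hik hjm := by
    have h := RingQuot.mkAlgHom_rel ℂ (AqRel.cross (q := q) i k j m hik hjm)
    rwa [map_sub, sub_eq_iff_eq_add', map_smul, map_mul, map_mul, map_mul] at h

theorem qDet_mul_detInv : qDet q (t q) * detInv n q = 1 := by
  have h := RingQuot.mkAlgHom_rel ℂ (AqRel.det_mul_d (n := n) (q := q))
  rwa [map_mul, map_qDet, map_one] at h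

theorem detInv_mul_qDet : detInv n q * qDet q (t q) = 1 := by
  have h := RingQuot.mkAlgHom_rel ℂ (AqRel.d_mul_det (n := n) (q := q))
  rwa [map_mul, map_qDet, map_one] at h

theorem commute_detInv_t (hq : q ≠ 0) (i j : Fin n) : Commute (detInv n q) (t q i j) :=
  Commute.units_inv_left (u := ⟨qDet q (t q), detInv n q, qDet_mul_detInv, detInv_mul_qDet⟩)
    (isQuantumMatrix_t.commute_qDet hq i j)

theorem t_mul_antipodeT (hq : q ≠ 0) :
    (.of (t q) * .of (antipodeT q) : Matrix (Fin n) (Fin n) (Aq n q)) = 1 := by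
  ext i k
  have h := congrArg (· * detInv n q) (congrFun₂ (isQuantumMatrix_t.mul_qAdjugate hq) i k)
  have hdet : qDet q (Matrix.of (t q)) * detInv n q = 1 := qDet_mul_detInv
  simp only [Matrix.mul_apply, Finset.sum_mul, qAdjugate, Matrix.of_apply, mul_smul_comm,
    smul_mul_assoc, mul_assoc, Matrix.diagonal_apply, ite_mul, zero_mul, hdet,
    Matrix.one_apply, antipodeT] at h ⊢
  exact h

theorem antipodeT_mul_t (hq : q ≠ 0) :
    (.of (antipodeT q) * .of (t q) : Matrix (Fin n) (Fin n) (Aq n q)) = 1 := by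
  ext i k
  have h := congrArg (· * detInv n q) (congrFun₂ (isQuantumMatrix_t.qAdjugate_mul hq) i k)
  have hdet : qDet q (Matrix.of (t q)) * detInv n q = 1 := qDet_mul_detInv
  simp only [Matrix.mul_apply, Finset.sum_mul, qAdjugate, Matrix.of_apply, smul_mul_assoc,
    mul_assoc, Matrix.diagonal_apply, ite_mul, zero_mul, hdet, Matrix.one_apply,
    antipodeT, (commute_detInv_t hq _ _).eq] at h ⊢
  exact h

theorem isQuantumMatrix_tStar (hq : q ≠ 0) :
    IsQuantumMatrix (q : ℂ) (.of fun i j : Fin n => tStar q i.rev j.rev) :=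
  isQuantumMatrix_t.inverse (by exact_mod_cast hq) (t_mul_antipodeT hq) (antipodeT_mul_t hq)
    Fin.rev_strictAnti

theorem tStar_mul_t_exchange (hq : q ≠ 0) (i j k m : Fin n) :
    ∑ p, ∑ b, braiding (q : ℂ) (p, k) (b, m) • (tStar q p i * t q b j)
      = ∑ c, ∑ d, braiding (q : ℂ) (i, c) (j, d) • (t q k c * tStar q m d) :=
  isQuantumMatrix_t.exchange (by exact_mod_cast hq) (t_mul_antipodeT hq) (antipodeT_mul_t hq)
    i j k m

theorem res_t (i j : Fin n) : res n q (t q i j) = if i = j then zPow (Pi.single i 1) else 0 := by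
  rw [res, t, RingQuot.liftAlgHom_mkAlgHom_apply, FreeAlgebra.lift_ι_apply]
  rfl

theorem res_tStar (hq : q ≠ 0) (i j : Fin n) :
    res n q (tStar q i j) = if i = j then zPow (-Pi.single i 1) else 0 := by
  have h := congrArg (res n q) (congrFun₂ (t_mul_antipodeT (n := n) hq) j i)
  simp only [Matrix.mul_apply, Matrix.of_apply, Matrix.one_apply, map_sum, map_mul, res_t,
    ite_mul, zero_mul, Finset.sum_ite_eq, Finset.mem_univ, if_true] at h
  have hunit : zPow (-Pi.single j 1) * zPow (Pi.single j 1) = (1 : Torus n) := by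
    rw [zPow_mul, neg_add_cancel]
    rfl
  calc res n q (tStar q i j)
    _ = zPow (-Pi.single j 1) * (zPow (Pi.single j 1) * res n q (antipodeT q j i)) := by
      rw [← mul_assoc, hunit, one_mul, tStar]
    _ = if i = j then zPow (-Pi.single i 1) else 0 := by
      rw [h]
      by_cases hij : i = j
      · simp [hij]
      · simp [hij, Ne.symm hij]

end Antipode

section ExteriorAlgebras

variable {n : ℕ} {q : ℝ}

theorem isExterior_lv (hq : q ≠ 0) : IsExterior (q : ℂ) (lv q : Fin n → L n q) where
  sq i := by
    have h := RingQuot.mkAlgHom_rel ℂ (LRel.sq (n := n) (q := q) i)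
    rwa [map_mul, map_zero] at h
  swap i j hij := by
    have h := RingQuot.mkAlgHom_rel ℂ (LRel.swap (q := q) i j hij)
    rw [map_smul, map_mul, map_mul] at h
    rw [lv, lv, h, smul_smul, neg_mul_neg, mul_inv_cancel₀ (by exact_mod_cast hq), one_smul]

theorem isExterior_ldv (hq : q ≠ 0) :
    IsExterior (q : ℂ) (fun i => ldv q i.rev : Fin n → Ld n q) where
  sq i := by
    have h := RingQuot.mkAlgHom_rel ℂ (LdRel.sq (n := n) (q := q) i.rev)
    rwa [map_mul, map_zero] at h
  swap i j hij := by
    have h := RingQuot.mkAlgHom_rel ℂ (LdRel.swap (q := q) j.rev i.rev (Fin.rev_lt_rev.2 hij))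
    rw [map_smul, map_mul, map_mul] at h
    rw [ldv, ldv, h, smul_smul, neg_mul_neg, mul_inv_cancel₀ (by exact_mod_cast hq), one_smul]

variable {B : Type*} [Ring B] [Algebra ℂ B]

theorem IsExterior.exists_lift (hq : q ≠ 0) {e : Fin n → B} (he : IsExterior (q : ℂ) e) :
    ∃ f : L n q →ₐ[ℂ] B, ∀ i, f (lv q i) = e i := by
  have hrel ⦃x y : FreeAlgebra ℂ (Fin n)⦄ (h : LRel n q x y) :
      FreeAlgebra.lift ℂ e x = FreeAlgebra.lift ℂ e y := by
    cases h with
    | sq i => simp [he.sq]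
    | swap i j hij =>
      simp only [map_mul, map_smul, FreeAlgebra.lift_ι_apply]
      rw [he.swap i j hij, smul_smul, neg_mul_neg, inv_mul_cancel₀ (by exact_mod_cast hq), one_smul]
  refine ⟨RingQuot.liftAlgHom ℂ ⟨FreeAlgebra.lift ℂ e, hrel⟩, fun i => ?_⟩
  rw [lv, RingQuot.liftAlgHom_mkAlgHom_apply, FreeAlgebra.lift_ι_apply]

theorem IsExterior.exists_lift_dual (hq : q ≠ 0) {e : Fin n → B}
    (he : IsExterior (q : ℂ) fun i : Fin n => e i.rev) :
    ∃ f : Ld n q →ₐ[ℂ] B, ∀ i, f (ldv q i) = e i := by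
  have hrel ⦃x y : FreeAlgebra ℂ (Fin n)⦄ (h : LdRel n q x y) :
      FreeAlgebra.lift ℂ e x = FreeAlgebra.lift ℂ e y := by
    cases h with
    | sq i => simpa using he.sq i.rev
    | swap i j hij =>
      have hswap := he.swap j.rev i.rev (Fin.rev_lt_rev.2 hij)
      simp only [Fin.rev_rev] at hswap
      simp only [map_mul, map_smul, FreeAlgebra.lift_ι_apply]
      rw [hswap, smul_smul, neg_mul_neg, inv_mul_cancel₀ (by exact_mod_cast hq), one_smul]
  refine ⟨RingQuot.liftAlgHom ℂ ⟨FreeAlgebra.lift ℂ e, hrel⟩, fun i => ?_⟩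
  rw [ldv, RingQuot.liftAlgHom_mkAlgHom_apply, FreeAlgebra.lift_ι_apply]

theorem exists_isCoactionL (hq : q ≠ 0) :
    ∃ ρ : L n q →ₐ[ℂ] L n q ⊗[ℂ] Aq n q, IsCoactionL ρ :=
  ((isExterior_lv hq).tensor (by exact_mod_cast hq) isQuantumMatrix_t).exists_lift hq

theorem exists_isCoactionLd (hq : q ≠ 0) :
    ∃ ρ : Ld n q →ₐ[ℂ] Ld n q ⊗[ℂ] Aq n q, IsCoactionLd ρ := by
  refine IsExterior.exists_lift_dual (e := fun j => ∑ i, ldv q i ⊗ₜ[ℂ] tStar q i j) hq ?_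
  convert (isExterior_ldv hq).tensor (by exact_mod_cast hq) (isQuantumMatrix_tStar (n := n) hq)
    using 2 with j
  exact (Equiv.sum_comp Fin.revPerm fun i => ldv q i ⊗ₜ[ℂ] tStar q i j.rev).symm

end ExteriorAlgebras

/-! ### The intertwiner property and surjectivity -/

section Intertwiner

variable {n r : ℕ} {q : ℝ}

theorem matrixCoaction_basis {ι M : Type*} [Fintype ι] [AddCommMonoid M] [Module ℂ M]
    (b : Module.Basis ι ℂ M) (x : ι → ι → Aq n q) (j : ι) :
    matrixCoaction b x (b j) = ∑ i, b i ⊗ₜ[ℂ] x i j := by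
  rw [matrixCoaction, Module.Basis.constr_basis]

theorem isIntertwiner_matrixCoaction {ι κ M N : Type*} [Fintype ι] [Fintype κ] [AddCommMonoid M]
    [Module ℂ M] [AddCommMonoid N] [Module ℂ N] (b : Module.Basis ι ℂ M) (c : Module.Basis κ ℂ N)
    (x : ι → ι → Aq n q) (y : κ → κ → Aq n q) (f : M →ₗ[ℂ] N)
    (h : ∀ i j, ∑ k, c.repr (f (b k)) i • x k j = ∑ k, c.repr (f (b j)) k • y i k) :
    IsIntertwiner (matrixCoaction b x) (matrixCoaction c y) f := by
  refine b.ext fun j => ?_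
  calc matrixCoaction c y (f (b j))
      = ∑ k, ∑ i, c i ⊗ₜ[ℂ] (c.repr (f (b j)) k • y i k) := by
        conv_lhs => rw [← c.sum_repr (f (b j))]
        simp only [map_sum, map_smul, matrixCoaction_basis, Finset.smul_sum,
          TensorProduct.tmul_smul]
    _ = ∑ i, c i ⊗ₜ[ℂ] ∑ k, c.repr (f (b k)) i • x k j := by
        simp only [h, TensorProduct.tmul_sum]
        exact Finset.sum_comm
    _ = ∑ k, (∑ i, c.repr (f (b k)) i • c i) ⊗ₜ[ℂ] x k j := by
        simp only [TensorProduct.tmul_sum, TensorProduct.sum_tmul, TensorProduct.tmul_smul,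
          TensorProduct.smul_tmul']
        exact Finset.sum_comm
    _ = LinearMap.rTensor (Aq n q) f (matrixCoaction b x (b j)) := by
        simp only [c.sum_repr, matrixCoaction_basis, map_sum, LinearMap.rTensor_tmul]

theorem IsIntertwiner.comp {M N P : Type*} [AddCommMonoid M] [Module ℂ M] [AddCommMonoid N]
    [Module ℂ N] [AddCommMonoid P] [Module ℂ P] {ρ₁ : M →ₗ[ℂ] M ⊗[ℂ] Aq n q}
    {ρ₂ : N →ₗ[ℂ] N ⊗[ℂ] Aq n q} {ρ₃ : P →ₗ[ℂ] P ⊗[ℂ] Aq n q} {f : M →ₗ[ℂ] N} {g : N →ₗ[ℂ] P}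
    (hg : IsIntertwiner ρ₂ ρ₃ g) (hf : IsIntertwiner ρ₁ ρ₂ f) : IsIntertwiner ρ₁ ρ₃ (g ∘ₗ f) := by
  unfold IsIntertwiner at *
  rw [← LinearMap.comp_assoc, hg, LinearMap.comp_assoc, hf, ← LinearMap.comp_assoc,
    LinearMap.rTensor_comp]

theorem IsIntertwiner.id {M : Type*} [AddCommMonoid M] [Module ℂ M]
    (ρ : M →ₗ[ℂ] M ⊗[ℂ] Aq n q) : IsIntertwiner ρ ρ (1 : Module.End ℂ M) := by
  unfold IsIntertwiner
  rw [Module.End.one_eq_id, LinearMap.rTensor_id, LinearMap.comp_id, LinearMap.id_comp]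

theorem repr_beta (i j k m : Fin n) :
    (bVVd n).repr (beta n q (bVd n i ⊗ₜ[ℂ] bV n j)) (k, m) = braiding (q : ℂ) (i, k) (j, m) := by
  have tmul_basis (a b : Fin n) : bV n a ⊗ₜ[ℂ] bVd n b = bVVd n (a, b) := by
    rw [bVVd, Module.Basis.tensorProduct_apply]
  rw [beta, ← Module.Basis.tensorProduct_apply, Module.Basis.constr_basis]
  simp only [tmul_basis, map_add, map_smul, map_sum, Module.Basis.repr_self, Finsupp.add_apply,
    Finsupp.smul_apply, Finsupp.coe_finsetSum, Finset.sum_apply, smul_eq_mul, braiding,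
    Finsupp.single_apply, Prod.mk.injEq, Prod.swap_prod_mk]
  congr 1
  · grind
  · by_cases hij : i = j
    · by_cases hkm : k = m
      · simp [hij, hkm, Finset.sum_ite_eq']
      · rw [Finset.sum_eq_zero fun a _ => if_neg fun h => hkm (h.1.symm.trans h.2)]
        simp [hkm]
    · simp [hij]

theorem betaAt_basis (i j : Fin r) (a b : Fin r → Fin n) :
    betaAt n q i j (bMix n r (a, b)) = ∑ k, ∑ m, braiding (q : ℂ) (b i, k) (a j, m) •
      bMix n r (Function.update a j k, Function.update b i m) := by
  rw [betaAt, Module.Basis.constr_basis]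
  simp only [repr_beta]

section Update

variable {ι κ M : Type*} [DecidableEq ι]

theorem eq_update_apply_comm {a b : ι → κ} {j : ι} :
    a = Function.update b j (a j) ↔ b = Function.update a j (b j) := by
  simp only [funext_iff, Function.update_apply]
  grind

theorem sum_ite_eq_update [Fintype ι] [Fintype κ] [DecidableEq κ] [AddCommMonoid M] (a : ι → κ)
    (j : ι) (f : (ι → κ) → M) :
    ∑ b, (if b = Function.update a j (b j) then f b else 0) = ∑ k, f (Function.update a j k) := by
  rw [← Finset.sum_filter]
  refine Finset.sum_nbij' (fun b => b j) (Function.update a j) ?_ ?_ ?_ ?_ ?_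
  · simp
  · simp
  · intro b hb
    exact (Finset.mem_filter.mp hb).2.symm
  · simp
  · intro b hb
    exact congrArg f (Finset.mem_filter.mp hb).2

end Update

theorem repr_betaAt (i j : Fin r) (p p' : (Fin r → Fin n) × (Fin r → Fin n)) :
    (bMix n r).repr (betaAt n q i j (bMix n r p)) p' =
      if p'.1 = Function.update p.1 j (p'.1 j) then
        if p'.2 = Function.update p.2 i (p'.2 i) then
          braiding (q : ℂ) (p.2 i, p'.1 j) (p.1 j, p'.2 i) else 0 else 0 := by
  obtain ⟨a, b⟩ := p
  obtain ⟨a', b'⟩ := p'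
  have update_eq {c c' : Fin r → Fin n} {s : Fin r} {k : Fin n} :
      Function.update c s k = c' ↔ c' = Function.update c s (c' s) ∧ k = c' s := by
    constructor
    · rintro rfl
      simp
    · rintro ⟨h, rfl⟩
      exact h.symm
  simp only [betaAt_basis, map_sum, map_smul, Module.Basis.repr_self, Finsupp.coe_finsetSum,
    Finset.sum_apply, Finsupp.smul_apply, Finsupp.single_apply, Prod.mk.injEq, update_eq, ite_and]
  split_ifs <;> simp

theorem sum_repr_betaAt_smul {M : Type*} [AddCommMonoid M] [Module ℂ M] (i j : Fin r)
    (a b : Fin r → Fin n) (F : (Fin r → Fin n) × (Fin r → Fin n) → M) :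
    ∑ p, (bMix n r).repr (betaAt n q i j (bMix n r (a, b))) p • F p
      = ∑ k, ∑ m, braiding (q : ℂ) (b i, k) (a j, m) •
          F (Function.update a j k, Function.update b i m) := by
  simp only [repr_betaAt, Fintype.sum_prod_type, ite_smul, zero_smul, sum_ite_eq_update,
    Finset.sum_ite_irrel, Finset.sum_const_zero, Function.update_self]

theorem sum_smul_repr_betaAt {M : Type*} [AddCommMonoid M] [Module ℂ M] (i j : Fin r)
    (a b : Fin r → Fin n) (F : (Fin r → Fin n) × (Fin r → Fin n) → M) :
    ∑ p, (bMix n r).repr (betaAt n q i j (bMix n r p)) (a, b) • F p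
      = ∑ m, ∑ k, braiding (q : ℂ) (k, a j) (m, b i) •
          F (Function.update a j m, Function.update b i k) := by
  simp only [repr_betaAt, Fintype.sum_prod_type, ite_smul, zero_smul, eq_update_apply_comm (a := a),
    eq_update_apply_comm (a := b), sum_ite_eq_update, Finset.sum_ite_irrel, Finset.sum_const_zero,
    Function.update_self]

/-- The coefficient of the coaction on a factor `V_k` or `V_k^*`, from the index `p` to the
index `p'` of `bMix`. -/
noncomputable def factorCoef (q : ℝ) (p' p : (Fin r → Fin n) × (Fin r → Fin n)) :
    Fin r ⊕ Fin r → Aq n q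
  | Sum.inl k => t q (p'.1 k) (p.1 k)
  | Sum.inr k => tStar q (p'.2 k) (p.2 k)

/-- The coaction on the tensor product of the factors `V_k`, `V_k^*` in the order given by `W`,
where `Sum.inl k` stands for `V_k` and `Sum.inr k` for `V_k^*`. -/
noncomputable def wordCoaction (n : ℕ) (q : ℝ) {r : ℕ} (W : List (Fin r ⊕ Fin r)) :
    VPow n r ⊗[ℂ] VdPow n r →ₗ[ℂ] (VPow n r ⊗[ℂ] VdPow n r) ⊗[ℂ] Aq n q :=
  matrixCoaction (bMix n r) fun p' p => (W.map (factorCoef q p' p)).prod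

theorem map_factorCoef_update_right {W : List (Fin r ⊕ Fin r)} {i j : Fin r}
    (hi : Sum.inr i ∉ W) (hj : Sum.inl j ∉ W) (p : (Fin r → Fin n) × (Fin r → Fin n))
    (a b : Fin r → Fin n) (k m : Fin n) :
    W.map (factorCoef q p (Function.update a j k, Function.update b i m))
      = W.map (factorCoef q p (a, b)) := by
  refine List.map_congr_left fun x hx => ?_
  rcases x with s | s
  · simp [factorCoef, ne_of_mem_of_not_mem hx hj |> mt (congrArg Sum.inl)]
  · simp [factorCoef, ne_of_mem_of_not_mem hx hi |> mt (congrArg Sum.inr)]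

theorem map_factorCoef_update_left {W : List (Fin r ⊕ Fin r)} {i j : Fin r}
    (hi : Sum.inr i ∉ W) (hj : Sum.inl j ∉ W) (p : (Fin r → Fin n) × (Fin r → Fin n))
    (a b : Fin r → Fin n) (k m : Fin n) :
    W.map (factorCoef q (Function.update a j k, Function.update b i m) p)
      = W.map (factorCoef q (a, b) p) := by
  refine List.map_congr_left fun x hx => ?_
  rcases x with s | s
  · simp [factorCoef, ne_of_mem_of_not_mem hx hj |> mt (congrArg Sum.inl)]
  · simp [factorCoef, ne_of_mem_of_not_mem hx hi |> mt (congrArg Sum.inr)]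

theorem betaAt_intertwiner (hq : q ≠ 0) {W₁ W₂ : List (Fin r ⊕ Fin r)} {i j : Fin r}
    (hi₁ : Sum.inr i ∉ W₁) (hj₁ : Sum.inl j ∉ W₁) (hi₂ : Sum.inr i ∉ W₂) (hj₂ : Sum.inl j ∉ W₂) :
    IsIntertwiner (wordCoaction n q (W₁ ++ Sum.inr i :: Sum.inl j :: W₂))
      (wordCoaction n q (W₁ ++ Sum.inl j :: Sum.inr i :: W₂)) (betaAt n q i j) := by
  refine isIntertwiner_matrixCoaction _ _ _ _ _ fun ⟨a', b'⟩ ⟨a, b⟩ => ?_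
  rw [sum_repr_betaAt_smul, sum_smul_repr_betaAt, Finset.sum_comm]
  simp only [List.map_append, List.map_cons, map_factorCoef_update_right hi₁ hj₁,
    map_factorCoef_update_left hi₁ hj₁, map_factorCoef_update_right hi₂ hj₂,
    map_factorCoef_update_left hi₂ hj₂, List.prod_append, List.prod_cons, factorCoef,
    Function.update_self]
  have exchange := congrArg (fun z => (W₁.map (factorCoef q (a', b') (a, b))).prod * (z *
    (W₂.map (factorCoef q (a', b') (a, b))).prod))
    (tStar_mul_t_exchange hq (b i) (a j) (a' j) (b' i))
  simpa only [Finset.sum_mul, Finset.mul_sum, smul_mul_assoc, mul_smul_comm, mul_assoc]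
    using exchange

theorem betaAt_prod_intertwiner (hq : q ≠ 0) {j : Fin r} {is : List (Fin r)} (his : is.Nodup)
    {W₁ W₂ : List (Fin r ⊕ Fin r)} (hj₁ : Sum.inl j ∉ W₁) (hj₂ : Sum.inl j ∉ W₂)
    (hi₁ : ∀ i ∈ is, Sum.inr i ∉ W₁) (hi₂ : ∀ i ∈ is, Sum.inr i ∉ W₂) :
    IsIntertwiner (wordCoaction n q (W₁ ++ is.map Sum.inr ++ Sum.inl j :: W₂))
      (wordCoaction n q (W₁ ++ Sum.inl j :: (is.map Sum.inr ++ W₂)))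
      ((is.map fun i => betaAt n q i j).prod : Module.End ℂ _) := by
  induction is generalizing W₁ with
  | nil => simpa using IsIntertwiner.id _
  | cons i is ih =>
    rw [List.nodup_cons] at his
    rw [List.forall_mem_cons] at hi₁ hi₂
    have move_rest := ih his.2 (W₁ := W₁ ++ [Sum.inr i]) (by simpa using hj₁)
      (fun k hk => by simpa using ⟨hi₁.2 k hk, ne_of_mem_of_not_mem hk his.1⟩) hi₂.2
    have move_first := betaAt_intertwiner (n := n) (W₂ := is.map Sum.inr ++ W₂) hq hi₁.1 hj₁
      (by simpa using ⟨his.1, hi₂.1⟩) (by simpa using hj₂)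
    rw [List.map_cons (f := fun i => betaAt n q i j), List.prod_cons]
    exact IsIntertwiner.comp (g := betaAt n q i j) (by simpa using move_first)
      (by simpa using move_rest)

/-- The order of the factors when `V_k` has been moved to the left for all `k` in `l₁`, while the
pairs `V_k ⊗ V_k^*` with `k` in `l₂` have not been touched. -/
def factorOrder (l₁ l₂ : List (Fin r)) : List (Fin r ⊕ Fin r) :=
  l₁.map Sum.inl ++ l₁.map Sum.inr ++ l₂.flatMap fun j => [Sum.inl j, Sum.inr j]

theorem betaAt_prod_prod_intertwiner (hq : q ≠ 0) (l₁ l₂ : List (Fin r))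
    (h : List.finRange r = l₁ ++ l₂) :
    IsIntertwiner (wordCoaction n q (factorOrder l₁ l₂))
      (wordCoaction n q (factorOrder (l₁ ++ l₂) []))
      ((l₂.reverse.map fun j =>
          (((List.finRange r).filter fun i => i < j).map fun i => betaAt n q i j).prod).prod :
        Module.End ℂ _) := by
  induction l₂ generalizing l₁ with
  | nil => simpa using IsIntertwiner.id _
  | cons j l₂ ih =>
    have move_rest := ih (l₁ ++ [j]) (by simpa using h)
    have filter_lt_eq : (List.finRange r).filter (fun i => i < j) = l₁ := by
      have sorted := List.pairwise_lt_finRange r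
      rw [h, List.pairwise_append, List.pairwise_cons] at sorted
      rw [h, List.filter_append, List.filter_eq_self.mpr, List.filter_eq_nil_iff.mpr,
        List.append_nil]
      · intro i hi
        rcases List.mem_cons.mp hi with rfl | hi
        · simp
        · simpa using (sorted.2.1.1 i hi).le
      · intro i hi
        simpa using sorted.2.2 i hi j (by simp)
    obtain ⟨hl₁, hl₂, hdisj⟩ := List.nodup_append.mp (h ▸ List.nodup_finRange r)
    have hj₁ : j ∉ l₁ := fun hj => hdisj j hj j List.mem_cons_self rfl
    have hj₂ : j ∉ l₂ := (List.nodup_cons.mp hl₂).1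
    have move_j := betaAt_prod_intertwiner (n := n) hq (j := j) hl₁ (W₁ := l₁.map Sum.inl)
      (W₂ := Sum.inr j :: l₂.flatMap fun j => [Sum.inl j, Sum.inr j])
      (by simpa using hj₁) (by simpa using hj₂) (by simp)
      (fun i hi => by simpa using ⟨ne_of_mem_of_not_mem hi hj₁,
        fun hi₂ => hdisj i hi i (List.mem_cons_of_mem j hi₂) rfl⟩)
    rw [List.reverse_cons, List.map_append, List.prod_append, List.map_singleton,
      List.prod_singleton, filter_lt_eq]
    refine IsIntertwiner.comp (g := List.prod _) (by simpa using move_rest) ?_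
    simpa [factorOrder] using move_j

theorem regroup_intertwiner : IsIntertwiner (coactSrc n q r)
    (wordCoaction n q (factorOrder [] (List.finRange r))) (regroup n r).toLinearMap := by
  refine (bSrc n r).ext fun x => ?_
  rw [LinearMap.comp_apply, LinearMap.comp_apply, coactSrc, matrixCoaction_basis, map_sum]
  simp only [LinearMap.rTensor_tmul, LinearEquiv.coe_coe, regroup, Module.Basis.equiv_apply,
    wordCoaction, matrixCoaction_basis]
  rw [← Equiv.sum_comp (Equiv.arrowProdEquivProdArrow (Fin r) (fun _ => Fin n) (fun _ => Fin n))]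
  refine Finset.sum_congr rfl fun y _ => ?_
  congr 1
  simp only [factorOrder, List.map_nil, List.nil_append, List.map_flatMap, List.ofFn_eq_map]
  induction List.finRange r with
  | nil => simp
  | cons k l ih =>
    simp only [List.map_cons, List.prod_cons, List.flatMap_cons, List.prod_append, ← ih]
    simp [factorCoef, Equiv.arrowProdEquivProdArrow]

theorem coaction_lword {ρ : L n q →ₐ[ℂ] L n q ⊗[ℂ] Aq n q} (hρ : IsCoactionL ρ)
    (a : Fin r → Fin n) : ρ (lword q a) = ∑ a' : Fin r → Fin n,
      lword q a' ⊗ₜ[ℂ] (List.ofFn fun k => t q (a' k) (a k)).prod := by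
  rw [lword, map_list_prod, List.map_ofFn]
  simp only [Function.comp_def, hρ _]
  exact prod_ofFn_sum_tmul (lv q) (.of (t q)) a

theorem coaction_ldword {ρ : Ld n q →ₐ[ℂ] Ld n q ⊗[ℂ] Aq n q} (hρ : IsCoactionLd ρ)
    (a : Fin r → Fin n) : ρ (ldword q a) = ∑ a' : Fin r → Fin n,
      ldword q a' ⊗ₜ[ℂ] (List.ofFn fun k => tStar q (a' k) (a k)).prod := by
  rw [ldword, map_list_prod, List.map_ofFn]
  simp only [Function.comp_def, hρ _]
  exact prod_ofFn_sum_tmul (ldv q) (.of (tStar q)) a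

theorem incl_pr_basis (a b : Fin r → Fin n) :
    incl n q r (TensorProduct.map (pr n q r) (prd n q r) (bMix n r (a, b)))
      = lword q a ⊗ₜ[ℂ] ldword q b := by
  rw [bMix, Module.Basis.tensorProduct_apply, TensorProduct.map_tmul, pr, prd,
    Module.Basis.constr_basis, Module.Basis.constr_basis, incl, TensorProduct.mapIncl,
    TensorProduct.map_tmul]
  rfl

theorem pr_intertwiner {ρ : L n q →ₐ[ℂ] L n q ⊗[ℂ] Aq n q} (hρ : IsCoactionL ρ)
    {ρd : Ld n q →ₐ[ℂ] Ld n q ⊗[ℂ] Aq n q} (hρd : IsCoactionLd ρd) :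
    IsIntertwiner (wordCoaction n q (factorOrder (List.finRange r) []))
      (tensorCoaction ρ.toLinearMap ρd.toLinearMap)
      (incl n q r ∘ₗ TensorProduct.map (pr n q r) (prd n q r)) := by
  refine (bMix n r).ext fun ⟨a, b⟩ => ?_
  rw [LinearMap.comp_apply, LinearMap.comp_apply, LinearMap.comp_apply, incl_pr_basis, wordCoaction,
    matrixCoaction_basis, map_sum]
  simp only [LinearMap.rTensor_tmul, LinearMap.comp_apply]
  rw [tensorCoaction, LinearMap.comp_apply, LinearMap.comp_apply, TensorProduct.map_tmul,
    AlgHom.toLinearMap_apply, AlgHom.toLinearMap_apply, coaction_lword hρ, coaction_ldword hρd]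
  simp only [TensorProduct.sum_tmul, TensorProduct.tmul_sum, map_sum, Fintype.sum_prod_type,
    LinearEquiv.coe_coe, TensorProduct.tensorTensorTensorComm_tmul, LinearMap.lTensor_tmul,
    LinearMap.mul'_apply, incl_pr_basis]
  rw [Finset.sum_comm]
  refine Finset.sum_congr rfl fun a' _ => Finset.sum_congr rfl fun b' _ => ?_
  simp [factorOrder, List.ofFn_eq_map, Function.comp_def, factorCoef]

theorem PsiHat_intertwiner (hq : q ≠ 0) {ρ : L n q →ₐ[ℂ] L n q ⊗[ℂ] Aq n q} (hρ : IsCoactionL ρ)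
    {ρd : Ld n q →ₐ[ℂ] Ld n q ⊗[ℂ] Aq n q} (hρd : IsCoactionLd ρd) :
    IsIntertwiner (coactSrc n q r) (tensorCoaction ρ.toLinearMap ρd.toLinearMap)
      (incl n q r ∘ₗ PsiHat n q r) := by
  rw [PsiHat, ← LinearMap.comp_assoc, Psi]
  exact (pr_intertwiner hρ hρd).comp
    ((betaAt_prod_prod_intertwiner hq [] _ (List.nil_append _).symm).comp regroup_intertwiner)

end Intertwiner

section Surjectivity

variable {n r : ℕ} {q : ℝ}

theorem sum_braiding_smul {ι K M : Type*} [LinearOrder ι] [Fintype ι] [Field K] [AddCommMonoid M]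
    [Module K M] (q : K) (i j : ι) (f : ι → ι → M) :
    ∑ k, ∑ m, braiding q (i, k) (j, m) • f k m =
      (if i = j then q⁻¹ else 1) • f j i
        + if i = j then (q⁻¹ - q) • ∑ k with k < j, f k k else 0 := by
  have sum_swap : ∑ k, ∑ m, (if (i, k) = (m, j) then if i = k then q⁻¹ else 1 else 0) • f k m
      = (if i = j then q⁻¹ else 1) • f j i := by
    simp [ite_and, ite_smul]
  have sum_diag (k : ι) : ∑ m, (if (i, k) = (j, m) ∧ k < i then q⁻¹ - q else 0) • f k m
      = if i = j then if k < j then (q⁻¹ - q) • f k k else 0 else 0 := by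
    by_cases hij : i = j <;> by_cases hk : k < j <;> simp [hij, hk, ite_smul]
  simp only [braiding, add_smul, Finset.sum_add_distrib, Prod.swap_prod_mk, sum_swap, sum_diag,
    Finset.sum_ite_irrel, Finset.sum_const_zero, Finset.smul_sum, Finset.sum_filter, smul_ite,
    smul_zero]

theorem betaAt_basis_of_ne {i j : Fin r} {a b : Fin r → Fin n} (h : b i ≠ a j) :
    betaAt n q i j (bMix n r (a, b)) = bMix n r (a, b) := by
  rw [betaAt_basis, sum_braiding_smul (q : ℂ) (b i) (a j) fun k m =>
    bMix n r (Function.update a j k, Function.update b i m)]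
  simp [h]

theorem betaAt_basis_of_eq {i j : Fin r} {a b : Fin r → Fin n} (h : b i = a j) :
    betaAt n q i j (bMix n r (a, b)) = (q : ℂ)⁻¹ • bMix n r (a, b) + ((q : ℂ)⁻¹ - q) •
      ∑ k with k < a j, bMix n r (Function.update a j k, Function.update b i k) := by
  rw [betaAt_basis, sum_braiding_smul (q : ℂ) (b i) (a j) fun k m =>
    bMix n r (Function.update a j k, Function.update b i m), if_pos h, if_pos h,
    Function.update_eq_self, Function.update_eq_self]

theorem betaAt_surjective (hq : q ≠ 0) (i j : Fin r) :
    Function.Surjective (betaAt n q i j) := by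
  rw [← LinearMap.range_eq_top, eq_top_iff, ← (bMix n r).span_eq, Submodule.span_le]
  rintro _ ⟨⟨a, b⟩, rfl⟩
  by_cases h : b i = a j
  · generalize hk : a j = k at h
    induction k using WellFoundedLT.induction generalizing a b with
    | ind k ih =>
      have leading_eq : (q : ℂ)⁻¹ • bMix n r (a, b) = betaAt n q i j (bMix n r (a, b)) +
          (-((q : ℂ)⁻¹ - q)) • ∑ m with m < a j,
            bMix n r (Function.update a j m, Function.update b i m) := by
        rw [betaAt_basis_of_eq (h.trans hk.symm), add_assoc, ← add_smul, add_neg_cancel, zero_smul,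
          add_zero]
      rw [SetLike.mem_coe, ← Submodule.smul_mem_iff _ (inv_ne_zero (Complex.ofReal_ne_zero.mpr hq)),
        leading_eq]
      refine Submodule.add_mem _ (LinearMap.mem_range_self _ _)
        (Submodule.smul_mem _ _ (Submodule.sum_mem _ fun m hm => ?_))
      exact ih m (hk ▸ (Finset.mem_filter.mp hm).2) _ _ (by simp) (by simp)
  · exact ⟨_, betaAt_basis_of_ne h⟩

theorem surjective_list_prod {R M : Type*} [Semiring R] [AddCommMonoid M] [Module R M]
    {l : List (Module.End R M)} (h : ∀ f ∈ l, Function.Surjective f) :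
    Function.Surjective l.prod :=
  List.prod_induction (fun f : Module.End R M => Function.Surjective f)
    (fun _ _ hf hg => hf.comp hg) Function.surjective_id h

theorem constr_span_surjective {ι R M N : Type*} [CommSemiring R] [AddCommMonoid M] [Module R M]
    [AddCommMonoid N] [Module R N] (b : Module.Basis ι R M) (v : ι → N) :
    Function.Surjective (b.constr R fun i =>
      (⟨v i, Submodule.subset_span ⟨i, rfl⟩⟩ : Submodule.span R (Set.range v))) := by
  have span_le_range : Submodule.span R (Set.range v) ≤
      LinearMap.range ((Submodule.span R (Set.range v)).subtype ∘ₗ b.constr R fun i =>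
        (⟨v i, Submodule.subset_span ⟨i, rfl⟩⟩ : Submodule.span R (Set.range v))) := by
    rw [Submodule.span_le]
    rintro _ ⟨i, rfl⟩
    exact ⟨b i, by simp⟩
  rintro ⟨x, hx⟩
  obtain ⟨y, hy⟩ := span_le_range hx
  exact ⟨y, Subtype.ext hy⟩

theorem PsiHat_surjective (hq : q ≠ 0) : Function.Surjective (PsiHat n q r) := by
  rw [PsiHat, LinearMap.coe_comp, Psi, LinearMap.coe_comp]
  refine (TensorProduct.map_surjective (constr_span_surjective _ _)
    (constr_span_surjective _ _)).comp
    ((surjective_list_prod fun f hf => ?_).comp (regroup n r).surjective)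
  obtain ⟨j, -, rfl⟩ := List.mem_map.mp hf
  refine surjective_list_prod fun g hg => ?_
  obtain ⟨i, -, rfl⟩ := List.mem_map.mp hg
  exact betaAt_surjective hq i j

end Surjectivity

/-! ### Principal terms -/

section Weights

variable {n r : ℕ} {q : ℝ}

theorem IsIntertwiner.weightComp {M N : Type*} [AddCommMonoid M] [Module ℂ M] [AddCommMonoid N]
    [Module ℂ N] {ρ : M →ₗ[ℂ] M ⊗[ℂ] Aq n q} {ρ' : N →ₗ[ℂ] N ⊗[ℂ] Aq n q} {f : M →ₗ[ℂ] N}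
    (hf : IsIntertwiner ρ ρ' f) (μ : Fin n → ℤ) (v : M) :
    weightComp ρ' μ (f v) = f (weightComp ρ μ v) := by
  have coaction_map : ρ' (f v) = LinearMap.rTensor (Aq n q) f (ρ v) := LinearMap.congr_fun hf v
  simp only [QGrass.weightComp, LinearMap.comp_apply, coaction_map, LinearEquiv.coe_coe]
  induction ρ v using TensorProduct.induction_on with
  | zero => simp
  | tmul x y => simp
  | add x y hx hy => simp only [map_add, hx, hy]

/-- The weight `∑_k (ε_{a_k} - ε_{b_k})` of the basis vector
`(v_{a₁} ⊗ v_{b₁}^*) ⊗ ⋯ ⊗ (v_{aᵣ} ⊗ v_{bᵣ}^*)` of `(V ⊗ V^*)^{⊗ r}`, where `x_k = (a_k, b_k)`. -/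
def srcWeight (x : Fin r → Fin n × Fin n) : Fin n → ℤ :=
  ∑ k, (Pi.single (x k).1 1 - Pi.single (x k).2 1)

theorem srcWeight_apply (x : Fin r → Fin n × Fin n) (i : Fin n) :
    srcWeight x i = (Finset.card {k | (x k).1 = i} : ℤ) - Finset.card {k | (x k).2 = i} := by
  simp [srcWeight, Finset.sum_apply, Pi.single_apply, eq_comm]

theorem zPow_sum {ι : Type*} (s : Finset ι) (μ : ι → Fin n → ℤ) :
    zPow (∑ i ∈ s, μ i) = ∏ i ∈ s, zPow (μ i) :=
  map_prod (AddMonoidAlgebra.of ℂ (Fin n → ℤ)) (fun i => Multiplicative.ofAdd (μ i)) s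

theorem res_list_prod (hq : q ≠ 0) (y x : Fin r → Fin n × Fin n) :
    res n q (List.ofFn fun k => t q (y k).1 (x k).1 * tStar q (y k).2 (x k).2).prod
      = if y = x then zPow (srcWeight x) else 0 := by
  rw [map_list_prod, List.map_ofFn, List.prod_ofFn]
  simp only [Function.comp_apply, map_mul, res_t, res_tStar hq]
  split_ifs with hyx
  · subst hyx
    simp only [if_true, zPow_mul, srcWeight, zPow_sum, sub_eq_add_neg]
  · obtain ⟨k, hk⟩ := Function.ne_iff.mp hyx
    refine Finset.prod_eq_zero (Finset.mem_univ k) ?_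
    rw [Ne, Prod.ext_iff, not_and_or] at hk
    rcases hk with hk | hk <;> simp [hk]

theorem weightComp_bSrc (hq : q ≠ 0) (μ : Fin n → ℤ) (x : Fin r → Fin n × Fin n) :
    weightComp (coactSrc n q r) μ (bSrc n r x) = if srcWeight x = μ then bSrc n r x else 0 := by
  rw [weightComp, LinearMap.comp_apply, LinearMap.comp_apply, coactSrc, matrixCoaction_basis,
    map_sum, map_sum]
  simp only [LinearMap.lTensor_tmul, LinearMap.comp_apply, AlgHom.toLinearMap_apply,
    res_list_prod hq]
  rw [Finset.sum_eq_single x]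
  · simp [zCoeff, zPow, Finsupp.single_apply]
  · intro y _ hyx
    simp [hyx]
  · simp

theorem pow_vecOf (X : Fin n → Fin n → ℝ) :
    pow r (vecOf X) = ∑ x : Fin r → Fin n × Fin n,
      (∏ k, (X (x k).1 (x k).2 : ℂ)) • bSrc n r x := by
  have vecOf_eq : vecOf X = ∑ p : Fin n × Fin n, (X p.1 p.2 : ℂ) • bVVd n p := by
    simp only [vecOf, Fintype.sum_prod_type, bVVd, Module.Basis.tensorProduct_apply]
  rw [← (bSrc n r).sum_repr (pow r (vecOf X))]
  refine Finset.sum_congr rfl fun x _ => ?_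
  rw [pow, bSrc, Basis.piTensorProduct_repr_tprod_apply]
  simp only [vecOf_eq, Module.Basis.repr_sum_self]

theorem PsiHat_bSrc_of_ne {a b : Fin r → Fin n} (h : ∀ i j, b i ≠ a j) :
    incl n q r (PsiHat n q r (bSrc n r fun k => (a k, b k))) = lword q a ⊗ₜ[ℂ] ldword q b := by
  have regroup_eq : regroup n r (bSrc n r fun k => (a k, b k)) = bMix n r (a, b) := by
    rw [regroup, Module.Basis.equiv_apply]
    rfl
  have list_prod_fixes (L : List (Module.End ℂ (VPow n r ⊗[ℂ] VdPow n r)))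
      (hL : ∀ f ∈ L, f (bMix n r (a, b)) = bMix n r (a, b)) :
      L.prod (bMix n r (a, b)) = bMix n r (a, b) :=
    (MulAction.stabilizerSubmonoid (Module.End ℂ (VPow n r ⊗[ℂ] VdPow n r))
      (bMix n r (a, b))).list_prod_mem hL
  rw [PsiHat, LinearMap.comp_apply, Psi, LinearMap.comp_apply, LinearEquiv.coe_coe, regroup_eq,
    list_prod_fixes, incl_pr_basis]
  intro f hf
  obtain ⟨j, -, rfl⟩ := List.mem_map.mp hf
  refine list_prod_fixes _ fun g hg => ?_
  obtain ⟨i, -, rfl⟩ := List.mem_map.mp hg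
  exact betaAt_basis_of_ne (h i j)

end Weights

section PowerSum

variable {ι K B : Type*} [LinearOrder ι] [Field K] [Ring B] [Algebra K B] {p : K}

/-- The `p`-factorial `∏_{j ≤ r} (1 + p + ⋯ + p^{j-1})`. -/
def qFactorial (p : K) (r : ℕ) : K :=
  ∏ j ∈ Finset.range r, ∑ k ∈ Finset.range (j + 1), p ^ k

theorem add_pow_of_mul_self_eq_zero {x y : B} (hx : x * x = 0) (hyx : y * x = p • (x * y))
    (m : ℕ) :
    (x + y) ^ (m + 1) = y ^ (m + 1) + (∑ k ∈ Finset.range (m + 1), p ^ k) • (x * y ^ m) := by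
  induction m with
  | zero => simp [add_comm]
  | succ m ih =>
    have x_mul : x * (x + y) ^ (m + 1) = x * y ^ (m + 1) := by
      rw [ih, mul_add, mul_smul_comm, ← mul_assoc, hx, zero_mul, smul_zero, add_zero]
    have y_mul : y * (x + y) ^ (m + 1) = y ^ (m + 2)
        + (∑ k ∈ Finset.range (m + 1), p ^ (k + 1)) • (x * y ^ (m + 1)) := by
      rw [ih, mul_add, mul_smul_comm, ← mul_assoc, hyx, smul_mul_assoc, mul_assoc, ← pow_succ',
        ← pow_succ', smul_smul, Finset.sum_mul]
      simp only [← pow_succ]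
    rw [pow_succ', add_mul, x_mul, y_mul, Finset.sum_range_succ' _ (m + 1), pow_zero, add_smul,
      one_smul]
    abel

theorem IsExterior.sum_pow {e : ι → B} (he : IsExterior (-p) e) (I : Finset ι) :
    (∑ i ∈ I, e i) ^ I.card = qFactorial p I.card • extProd e I ∧
      (∑ i ∈ I, e i) ^ (I.card + 1) = 0 := by
  induction I using Finset.induction_on_min with
  | empty => simp [qFactorial]
  | insert x I hx ih =>
    have hxI : x ∉ I := fun h => (hx x h).false
    have sum_mul_x : (∑ i ∈ I, e i) * e x = p • (e x * ∑ i ∈ I, e i) := by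
      rw [Finset.sum_mul, Finset.mul_sum, Finset.smul_sum]
      exact Finset.sum_congr rfl fun i hi => by rw [he.swap x i (hx i hi), neg_neg]
    rw [Finset.card_insert_of_notMem hxI, Finset.sum_insert hxI]
    constructor
    · rw [add_pow_of_mul_self_eq_zero (he.sq x) sum_mul_x, ih.2, zero_add, ih.1, mul_smul_comm,
        ← extProd_insert_of_forall_lt e hx, smul_smul, qFactorial, qFactorial,
        Finset.prod_range_succ, mul_comm]
    · rw [add_pow_of_mul_self_eq_zero (he.sq x) sum_mul_x, ih.2, mul_zero, smul_zero, add_zero,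
        pow_succ, ih.2, zero_mul]

theorem sum_pow_eq_sum_words {ι R : Type*} [Ring R] (e : ι → R) (I : Finset ι) (r : ℕ) :
    (∑ i ∈ I, e i) ^ r =
      ∑ a ∈ Fintype.piFinset fun _ : Fin r => I, (List.ofFn fun k => e (a k)).prod := by
  rw [← MultilinearMap.mkPiAlgebraFin_apply_const (R := ℤ), MultilinearMap.map_sum_finset]
  simp only [MultilinearMap.mkPiAlgebraFin_apply]

theorem IsExterior.sum_words [Fintype ι] (hp : p ≠ 0) {e : ι → B} (he : IsExterior (-p) e)
    (I : Finset ι) :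
    ∑ a : Fin I.card → ι with Function.Injective a ∧ Finset.univ.image a = I,
        (List.ofFn fun k => e (a k)).prod
      = qFactorial p I.card • extProd e I := by
  rw [← (he.sum_pow I).1, sum_pow_eq_sum_words]
  refine Finset.sum_subset (fun a ha => ?_) fun a ha ha' => ?_
  · obtain ⟨-, -, himage⟩ := Finset.mem_filter.mp ha
    exact Fintype.mem_piFinset.mpr fun k => himage ▸ Finset.mem_image_of_mem a (Finset.mem_univ k)
  · refine he.word_eq_zero (neg_ne_zero.mpr hp) fun hinj => ha' ?_
    refine Finset.mem_filter.mpr ⟨Finset.mem_univ a, hinj, Finset.eq_of_subset_of_card_le ?_ ?_⟩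
    · exact Finset.image_subset_iff.mpr fun k _ => Fintype.mem_piFinset.mp ha k
    · rw [Finset.card_image_of_injective _ hinj, Finset.card_univ, Fintype.card_fin]

end PowerSum

section Orbit

variable {n l r : ℕ}

theorem mem_orbit_iff (hrl : r ≤ l) (ν : Fin l → ℤ) :
    ν ∈ orbit l r ↔
      (∀ j, ν j = 0 ∨ ν j = 1 ∨ ν j = -1) ∧ Finset.card {j | ν j ≠ 0} = r := by
  have card_lt : Finset.card {j : Fin l | (j : ℕ) < r} = r := by
    rw [Fin.card_filter_val_lt, min_eq_right hrl]
  simp only [orbit, Finset.mem_image, Finset.mem_univ, true_and]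
  constructor
  · rintro ⟨⟨w, s⟩, rfl⟩
    constructor
    · intro j
      rcases Int.units_eq_one_or (w j) with hw | hw <;> by_cases hs : (s j : ℕ) < r <;>
        simp [hw, hs]
    · exact (Finset.card_equiv s fun j => by simp).trans card_lt
  · rintro ⟨hν, hcard⟩
    let e : {j // ν j ≠ 0} ≃ {j : Fin l // (j : ℕ) < r} :=
      Fintype.equivOfCardEq (by rw [Fintype.card_subtype, Fintype.card_subtype, hcard, card_lt])
    refine ⟨⟨fun j => if ν j = -1 then -1 else 1, e.extendSubtype⟩, funext fun j => ?_⟩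
    by_cases hj : ν j = 0
    · have := e.extendSubtype_not_mem j (by simpa using hj)
      simp [hj, this]
    · have := e.extendSubtype_mem j hj
      rcases (hν j).resolve_left hj with hj | hj <;> simp [hj, this]

theorem flat_rev (hln : 2 * l ≤ n) (ν : Fin l → ℤ) (i : Fin n) :
    flat n ν i.rev = -flat n ν i := by
  have hi := Fin.val_rev i
  unfold flat
  by_cases h : (i : ℕ) < l
  · have hrev : ¬ (i.rev : ℕ) < l := by omega
    simp [h, hrev, -Fin.val_rev]
  · by_cases hrev : (i.rev : ℕ) < l <;> simp [h, hrev, -Fin.val_rev]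

theorem flat_castLE (hln : l ≤ n) (ν : Fin l → ℤ) (j : Fin l) :
    flat n ν (Fin.castLE hln j) = ν j := by
  simp [flat]

theorem lt_or_rev_lt_of_flat_ne_zero {ν : Fin l → ℤ} {i : Fin n} (h : flat n ν i ≠ 0) :
    (i : ℕ) < l ∨ (i.rev : ℕ) < l := by
  by_contra! hi
  exact h (by simp [flat, hi.1.not_gt, hi.2.not_gt, -Fin.val_rev])

theorem card_flat_eq_one (hln : 2 * l ≤ n) {ν : Fin l → ℤ}
    (hν : ∀ j, ν j = 0 ∨ ν j = 1 ∨ ν j = -1) :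
    Finset.card {i | flat n ν i = 1} = Finset.card {j | ν j ≠ 0} := by
  have hln' : l ≤ n := by omega
  symm
  refine Finset.card_bij
    (fun j _ => if ν j = 1 then Fin.castLE hln' j else (Fin.castLE hln' j).rev) ?_ ?_ ?_
  · intro j hj
    rw [Finset.mem_filter_univ] at hj ⊢
    rcases (hν j).resolve_left hj with hj | hj <;> simp [hj, flat_rev hln, flat_castLE]
  · intro j _ j' _ h
    have hj := j.isLt
    have hj' := j'.isLt
    split_ifs at h <;> simp only [Fin.ext_iff, Fin.val_castLE, Fin.val_rev] at h ⊢ <;> omega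
  · intro i hi
    rw [Finset.mem_filter_univ] at hi
    rcases lt_or_rev_lt_of_flat_ne_zero (hi ▸ one_ne_zero) with h | h
    · have hν_i : ν ⟨i, h⟩ = 1 := by rw [← hi, ← flat_castLE hln' ν]; rfl
      exact ⟨⟨i, h⟩, by simp [hν_i], by rw [if_pos hν_i]; rfl⟩
    · have hν_i : ν ⟨i.rev, h⟩ = -1 := by rw [← hi, ← flat_rev hln, ← flat_castLE hln' ν]; rfl
      exact ⟨⟨i.rev, h⟩, by rw [Finset.mem_filter_univ, hν_i]; decide,
        by rw [hν_i, if_neg (by decide)]; exact Fin.rev_rev i⟩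

theorem mem_idx_iff {I : Finset (Fin n)} : I ∈ idx n l r ↔
    (∀ i ∈ I, (i : ℕ) < l ∨ (i.rev : ℕ) < l) ∧ I.card = r ∧ ∀ i ∈ I, i.rev ∉ I := by
  simp only [idx, Finset.mem_filter_univ]
  refine and_congr_right fun _ => and_congr_right fun _ => ?_
  rw [← Finset.disjoint_iff_inter_eq_empty, Finset.disjoint_right, Finset.forall_mem_image]

/-- The weight `∑_{i ∈ I} (ε_i - ε_{i'})` of `v_I ⊗ v_{I'}^*`. -/
def antiWeight (I : Finset (Fin n)) (i : Fin n) : ℤ :=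
  (if i ∈ I then 1 else 0) - if i.rev ∈ I then 1 else 0

theorem antiWeight_trichotomy (I : Finset (Fin n)) (i : Fin n) :
    antiWeight I i = 0 ∨ antiWeight I i = 1 ∨ antiWeight I i = -1 := by
  unfold antiWeight
  split_ifs <;> simp

theorem antiWeight_eq_one_iff {I : Finset (Fin n)} (hI : ∀ i ∈ I, i.rev ∉ I) {i : Fin n} :
    antiWeight I i = 1 ↔ i ∈ I := by
  unfold antiWeight
  by_cases hi : i ∈ I
  · simp [hi, hI i hi]
  · by_cases hrev : i.rev ∈ I <;> simp [hi, hrev]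

theorem flat_antiWeight (hln : l ≤ n) {I : Finset (Fin n)}
    (hI : ∀ i ∈ I, (i : ℕ) < l ∨ (i.rev : ℕ) < l) :
    flat n (fun j : Fin l => antiWeight I (Fin.castLE hln j)) = antiWeight I := by
  funext i
  unfold flat
  split_ifs with h hrev
  · rfl
  · change -antiWeight I i.rev = antiWeight I i
    rw [antiWeight, antiWeight, Fin.rev_rev, neg_sub]
  · have hi : i ∉ I := fun hi => (hI i hi).elim h hrev
    have hi_rev : i.rev ∉ I := fun hi => (hI _ hi).elim hrev (by rwa [Fin.rev_rev])
    simp [antiWeight, hi, hi_rev]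

theorem antiWeight_flat_eq_one (hln : 2 * l ≤ n) {ν : Fin l → ℤ}
    (hν : ∀ j, ν j = 0 ∨ ν j = 1 ∨ ν j = -1) :
    antiWeight {i | flat n ν i = 1} = flat n ν := by
  funext i
  have hi : flat n ν i = 0 ∨ flat n ν i = 1 ∨ flat n ν i = -1 := by
    unfold flat
    split_ifs
    · exact hν _
    · have := hν ⟨i.rev, ‹_›⟩
      omega
    · exact Or.inl rfl
  simp only [antiWeight, Finset.mem_filter_univ, flat_rev hln]
  rcases hi with hi | hi | hi <;> simp [hi]

theorem principalTerm_eq_sum_idx {q : ℝ} {M : Type*} [AddCommMonoid M] [Module ℂ M]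
    (ρ : M →ₗ[ℂ] M ⊗[ℂ] Aq n q) (hln : 2 * l ≤ n) (hrl : r ≤ l) (v : M) :
    principalTerm ρ l r v = ∑ I ∈ idx n l r, weightComp ρ (antiWeight I) v := by
  have hln' : l ≤ n := by omega
  refine Finset.sum_bij' (fun ν _ => ({i | flat n ν i = 1} : Finset (Fin n)))
    (fun I _ j => antiWeight I (Fin.castLE hln' j)) ?_ ?_ ?_ ?_ ?_
  · intro ν hν
    obtain ⟨hν, hcard⟩ := (mem_orbit_iff hrl ν).mp hν
    refine mem_idx_iff.mpr ⟨fun i hi => ?_, (card_flat_eq_one hln hν).trans hcard, fun i hi => ?_⟩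
    · rw [Finset.mem_filter_univ] at hi
      exact lt_or_rev_lt_of_flat_ne_zero (hi ▸ one_ne_zero)
    · rw [Finset.mem_filter_univ] at hi ⊢
      rw [flat_rev hln, hi]
      decide
  · intro I hI
    obtain ⟨houter, hcard, hrev⟩ := mem_idx_iff.mp hI
    refine (mem_orbit_iff hrl _).mpr ⟨fun j => antiWeight_trichotomy I _, ?_⟩
    rw [← card_flat_eq_one hln fun j => antiWeight_trichotomy I _, flat_antiWeight hln' houter]
    simpa only [antiWeight_eq_one_iff hrev, Finset.filter_univ_mem] using hcard
  · intro ν hν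
    rw [antiWeight_flat_eq_one hln ((mem_orbit_iff hrl ν).mp hν).1]
    exact funext fun j => flat_castLE hln' ν j
  · intro I hI
    obtain ⟨houter, -, hrev⟩ := mem_idx_iff.mp hI
    simp only [flat_antiWeight hln' houter, antiWeight_eq_one_iff hrev, Finset.filter_univ_mem]
  · intro ν hν
    rw [antiWeight_flat_eq_one hln ((mem_orbit_iff hrl ν).mp hν).1]

theorem card_filter_eq_of_injective {α β : Type*} [Fintype α] [DecidableEq β] {f : α → β}
    (hf : Function.Injective f) (b : β) :
    Finset.card {a | f a = b} = if b ∈ Finset.univ.image f then 1 else 0 := by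
  split_ifs with hb
  · obtain ⟨a, -, rfl⟩ := Finset.mem_image.mp hb
    exact Finset.card_eq_one.mpr ⟨a, by ext; simp [hf.eq_iff]⟩
  · simpa [Finset.filter_eq_empty_iff] using hb

theorem srcWeight_word {a : Fin r → Fin n} (ha : Function.Injective a) :
    srcWeight (fun k => (a k, (a k).rev)) = antiWeight (Finset.univ.image a) := by
  funext i
  simp only [srcWeight_apply, Fin.rev_eq_iff, card_filter_eq_of_injective ha, antiWeight]
  push_cast
  rfl

theorem eq_word_of_srcWeight_eq_antiWeight {x : Fin r → Fin n × Fin n}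
    (hx : ∀ k, (x k).1 = (x k).2 ∨ (x k).2 = (x k).1.rev) {I : Finset (Fin n)} (hI : I.card = r)
    (hrev : ∀ i ∈ I, i.rev ∉ I) (hweight : srcWeight x = antiWeight I) :
    ∃ a : Fin r → Fin n, (Function.Injective a ∧ Finset.univ.image a = I) ∧
      (fun k => (a k, (a k).rev)) = x := by
  have weight_eq_one {i : Fin n} (hi : i ∈ I) :
      (Finset.card {k | (x k).1 = i} : ℤ) - Finset.card {k | (x k).2 = i} = 1 := by
    rw [← srcWeight_apply, hweight, antiWeight_eq_one_iff hrev]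
    exact hi
  have subset_image : I ⊆ Finset.univ.image fun k => (x k).1 := by
    intro i hi
    have hcard : 0 < Finset.card {k | (x k).1 = i} := by
      have := weight_eq_one hi
      omega
    obtain ⟨k, hk⟩ := Finset.card_pos.mp hcard
    exact Finset.mem_image.mpr ⟨k, Finset.mem_univ k, (Finset.mem_filter_univ k).mp hk⟩
  have card_image_le : (Finset.univ.image fun k => (x k).1).card ≤ I.card := by
    simpa [hI] using Finset.card_image_le (s := Finset.univ) (f := fun k => (x k).1)
  have image_eq := Finset.eq_of_subset_of_card_le subset_image card_image_le
  have hinj : Function.Injective fun k => (x k).1 := by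
    rw [← Set.injOn_univ, ← Finset.coe_univ, ← Finset.card_image_iff, ← image_eq, hI]
    simp
  refine ⟨fun k => (x k).1, ⟨hinj, image_eq.symm⟩, funext fun k => Prod.ext rfl ?_⟩
  refine ((hx k).resolve_left fun hk => ?_).symm
  have mem_I : (x k).1 ∈ I := image_eq ▸ Finset.mem_image_of_mem _ (Finset.mem_univ k)
  have card_fst := card_filter_eq_of_injective hinj (x k).1
  rw [← image_eq, if_pos mem_I] at card_fst
  have card_snd : 0 < Finset.card {m | (x m).2 = (x k).1} :=
    Finset.card_pos.mpr ⟨k, by simp [hk]⟩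
  have := weight_eq_one mem_I
  omega

end Orbit

section PrincipalTerm

variable {n l r : ℕ} {q : ℝ}

theorem IsExterior.tmul {ι K A B : Type*} [LinearOrder ι] [Field K] [Ring A] [Algebra K A] [Ring B]
    [Algebra K B] {q : K} {e : ι → A} {f : ι → B} (he : IsExterior q e) (hf : IsExterior q f) :
    IsExterior (-q ^ 2) fun i => e i ⊗ₜ[K] f i where
  sq i := by rw [Algebra.TensorProduct.tmul_mul_tmul, he.sq, TensorProduct.zero_tmul]
  swap i j hij := by
    rw [Algebra.TensorProduct.tmul_mul_tmul, Algebra.TensorProduct.tmul_mul_tmul, he.swap i j hij,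
      hf.swap i j hij, TensorProduct.smul_tmul_smul]
    congr 1
    ring

theorem list_prod_map_tmul {ι K A B : Type*} [CommSemiring K] [Semiring A] [Algebra K A]
    [Semiring B] [Algebra K B] (f : ι → A) (g : ι → B) (L : List ι) :
    (L.map fun i => f i ⊗ₜ[K] g i).prod = (L.map f).prod ⊗ₜ[K] (L.map g).prod := by
  induction L with
  | nil => rfl
  | cons i L ih => simp [ih]

theorem reverse_sort_image_rev (I : Finset (Fin n)) :
    ((I.image Fin.rev).sort (· ≤ ·)).reverse = (I.sort (· ≤ ·)).map Fin.rev := by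
  refine List.Perm.eq_of_pairwise' (r := (· ≥ ·)) ?_ ?_ ?_
  · rw [List.pairwise_reverse]
    exact Finset.pairwise_sort _ (· ≤ ·)
  · rw [List.pairwise_map]
    exact (Finset.pairwise_sort I (· ≤ ·)).imp fun h => Fin.rev_le_rev.mpr h
  · refine (List.reverse_perm _).trans ?_
    rw [← Multiset.coe_eq_coe, Finset.sort_eq, ← Multiset.map_coe, Finset.sort_eq,
      Finset.image_val_of_injOn Fin.rev_injective.injOn]

theorem extProd_lv_tmul_ldv (I : Finset (Fin n)) :
    extProd (fun i => lv q i ⊗ₜ[ℂ] ldv q i.rev) I = vI q I ⊗ₜ[ℂ] vdI q (I.image Fin.rev) := by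
  rw [extProd, list_prod_map_tmul, vI, vdI, reverse_sort_image_rev, List.map_map]
  rfl

theorem lword_tmul_ldword (a b : Fin r → Fin n) :
    lword q a ⊗ₜ[ℂ] ldword q b = (List.ofFn fun k => lv q (a k) ⊗ₜ[ℂ] ldv q (b k)).prod := by
  rw [lword, ldword, List.ofFn_eq_map, List.ofFn_eq_map, List.ofFn_eq_map, list_prod_map_tmul]

variable {ρ : L n q →ₐ[ℂ] L n q ⊗[ℂ] Aq n q} {ρd : Ld n q →ₐ[ℂ] Ld n q ⊗[ℂ] Aq n q}
  {X : Fin n → Fin n → ℝ}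

theorem weightComp_PsiHat_pow_eq_sum_words (hq : q ≠ 0) (hρ : IsCoactionL ρ)
    (hρd : IsCoactionLd ρd) (hX : ∀ i j, X i j ≠ 0 → i = j ∨ j = i.rev) {I : Finset (Fin n)}
    (hI : I.card = r) (hrev : ∀ i ∈ I, i.rev ∉ I) :
    weightComp (tensorCoaction ρ.toLinearMap ρd.toLinearMap) (antiWeight I)
        (incl n q r (PsiHat n q r (pow r (vecOf X))))
      = ∑ a : Fin r → Fin n with Function.Injective a ∧ Finset.univ.image a = I,
          (∏ k, (X (a k) (a k).rev : ℂ)) •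
            (List.ofFn fun k => lv q (a k) ⊗ₜ[ℂ] ldv q (a k).rev).prod := by
  refine ((PsiHat_intertwiner hq hρ hρd).weightComp (antiWeight I) (pow r (vecOf X))).trans ?_
  simp only [pow_vecOf, map_sum, map_smul, weightComp_bSrc hq, LinearMap.comp_apply]
  symm
  refine Finset.sum_of_injOn (fun a k => (a k, (a k).rev)) ?_ (by simp) ?_ ?_
  · intro a _ a' _ h
    exact funext fun k => congrArg Prod.fst (congrFun h k)
  · intro x _ hx
    by_cases hzero : ∃ k, X (x k).1 (x k).2 = 0
    · obtain ⟨k, hk⟩ := hzero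
      rw [Finset.prod_eq_zero (Finset.mem_univ k) (by simp [hk]), zero_smul]
    · push Not at hzero
      rw [if_neg, map_zero, map_zero, smul_zero]
      intro hweight
      obtain ⟨a, ha, hax⟩ := eq_word_of_srcWeight_eq_antiWeight (fun k => hX _ _ (hzero k)) hI hrev
        hweight
      exact hx ⟨a, by simpa using ha, hax⟩
  · intro a ha
    obtain ⟨hinj, rfl⟩ := (Finset.mem_filter_univ a).mp ha
    rw [if_pos (srcWeight_word hinj), PsiHat_bSrc_of_ne, lword_tmul_ldword]
    intro i j hij
    exact hrev (a i) (Finset.mem_image_of_mem a (Finset.mem_univ i))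
      (hij ▸ Finset.mem_image_of_mem a (Finset.mem_univ j))

theorem weightComp_PsiHat_pow (hq : q ≠ 0) (hρ : IsCoactionL ρ) (hρd : IsCoactionLd ρd)
    (hX : ∀ i j, X i j ≠ 0 → i = j ∨ j = i.rev) {I : Finset (Fin n)} (hI : I.card = r)
    (hrev : ∀ i ∈ I, i.rev ∉ I) :
    weightComp (tensorCoaction ρ.toLinearMap ρd.toLinearMap) (antiWeight I)
        (incl n q r (PsiHat n q r (pow r (vecOf X))))
      = (((∏ i ∈ I, X i i.rev) * qFactorial (q ^ 2) r : ℝ) : ℂ) •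
          (vI q I ⊗ₜ[ℂ] vdI q (I.image Fin.rev)) := by
  have hext : IsExterior (-(q : ℂ) ^ 2) fun i : Fin n => lv q i ⊗ₜ[ℂ] ldv q i.rev :=
    (isExterior_lv hq).tmul (isExterior_ldv hq)
  have qFactorial_coe : ((qFactorial (q ^ 2) r : ℝ) : ℂ) = qFactorial ((q : ℂ) ^ 2) r := by
    simp [qFactorial]
  rw [weightComp_PsiHat_pow_eq_sum_words hq hρ hρd hX hI hrev]
  subst hI
  rw [← extProd_lv_tmul_ldv, Complex.ofReal_mul, qFactorial_coe, mul_smul,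
    ← hext.sum_words (pow_ne_zero 2 (Complex.ofReal_ne_zero.mpr hq)) I, Finset.smul_sum]
  refine Finset.sum_congr rfl fun a ha => ?_
  obtain ⟨hinj, himage⟩ := (Finset.mem_filter_univ a).mp ha
  have prod_eq : ∏ i ∈ I, X i i.rev = ∏ k, X (a k) (a k).rev :=
    (congrArg (fun s => ∏ i ∈ s, X i i.rev) himage.symm).trans (Finset.prod_image hinj.injOn)
  rw [prod_eq, Complex.ofReal_prod]

theorem principalTerm_PsiHat_pow (hq : q ≠ 0) (hln : 2 * l ≤ n) (hrl : r ≤ l)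
    (hρ : IsCoactionL ρ) (hρd : IsCoactionLd ρd) (hX : ∀ i j, X i j ≠ 0 → i = j ∨ j = i.rev) :
    principalTerm (tensorCoaction ρ.toLinearMap ρd.toLinearMap) l r
        (incl n q r (PsiHat n q r (pow r (vecOf X))))
      = ∑ I ∈ idx n l r, (((∏ i ∈ I, X i i.rev) * qFactorial (q ^ 2) r : ℝ) : ℂ) •
          (vI q I ⊗ₜ[ℂ] vdI q (I.image Fin.rev)) := by
  rw [principalTerm_eq_sum_idx _ hln hrl]
  refine Finset.sum_congr rfl fun I hI => ?_
  obtain ⟨-, hcard, hrev⟩ := mem_idx_iff.mp hI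
  exact weightComp_PsiHat_pow hq hρ hρd hX hcard hrev

end PrincipalTerm

section Constants

variable {n l r : ℕ} {q σ : ℝ}

theorem eq_or_eq_rev_of_J_ne_zero {i j : Fin n} (h : J n l q σ i j ≠ 0) : i = j ∨ j = i.rev := by
  by_contra! hij
  have hji : i ≠ j.rev := fun h => hij.2 (by rw [h, Fin.rev_rev])
  exact h (by simp [J, hij, hji])

theorem eq_or_eq_rev_of_Jt_ne_zero {i j : Fin n} (h : Jt n l q σ i j ≠ 0) : i = j ∨ j = i.rev := by
  by_contra! hij
  have hji : i ≠ j.rev := fun h => hij.2 (by rw [h, Fin.rev_rev])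
  exact h (by simp [Jt, hij, hji])

theorem ne_rev_and_rev_lt_iff (hln : 2 * l ≤ n) {i : Fin n} (hi : (i : ℕ) < l ∨ (i.rev : ℕ) < l) :
    i ≠ i.rev ∧ ((i.rev : ℕ) < l ↔ ¬ (i : ℕ) < l) := by
  rw [Ne, Fin.ext_iff]
  rw [Fin.val_rev] at *
  omega

theorem J_apply_rev (hln : 2 * l ≤ n) {i : Fin n} (hi : (i : ℕ) < l ∨ (i.rev : ℕ) < l) :
    J n l q σ i i.rev = -q ^ σ := by
  obtain ⟨hne, hiff⟩ := ne_rev_and_rev_lt_iff hln hi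
  by_cases h : (i : ℕ) < l <;> simp [J, hne, hiff, h, -Fin.val_rev]

theorem Jt_apply_rev (hq : q ≠ 0) (hln : 2 * l ≤ n) {i : Fin n}
    (hi : (i : ℕ) < l ∨ (i.rev : ℕ) < l) :
    Jt n l q σ i i.rev = -(q ^ (σ - 1) * q ^ (2 * (1 - (l : ℤ)))) * q ^ (2 * (i : ℕ)) := by
  obtain ⟨hne, hiff⟩ := ne_rev_and_rev_lt_iff hln hi
  have hexp : q ^ (2 * (1 - (l : ℤ))) * q ^ (2 * (i : ℕ)) = q ^ (2 * ((i : ℕ) + 1 - (l : ℤ))) := by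
    rw [← zpow_natCast q (2 * i), ← zpow_add₀ hq]
    congr 1
    push_cast
    ring
  rw [neg_mul, mul_assoc, hexp]
  by_cases h : (i : ℕ) < l <;> simp [Jt, hne, hiff, h, -Fin.val_rev]

theorem div_pow_mul_qPoch_eq {p : ℝ} (hp : p ≠ 1) (z : ℝ) (r : ℕ) :
    (z / (p - 1)) ^ r * qPoch p p r = (-z) ^ r * qFactorial p r := by
  have hp' : p - 1 ≠ 0 := sub_ne_zero.mpr hp
  have factor (j : ℕ) : 1 - p ^ j * p = -(p - 1) * ∑ k ∈ Finset.range (j + 1), p ^ k := by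
    rw [geom_sum_eq hp]
    field_simp
    ring
  rw [qPoch, qFactorial, Finset.prod_congr rfl fun j _ => factor j, Finset.prod_mul_distrib,
    Finset.prod_const, Finset.card_range, ← mul_assoc, ← mul_pow]
  congr 2
  field_simp

theorem sq_ne_one_of_pos (hq0 : 0 < q) (hq1 : q ≠ 1) : q ^ 2 ≠ 1 :=
  (pow_eq_one_iff_of_nonneg hq0.le two_ne_zero).not.mpr hq1

theorem qPoch_self_ne_zero {p : ℝ} (hp0 : 0 ≤ p) (hp1 : p ≠ 1) (r : ℕ) : qPoch p p r ≠ 0 := by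
  refine Finset.prod_ne_zero_iff.mpr fun j _ => ?_
  rw [← pow_succ, sub_ne_zero, ne_comm]
  exact (pow_eq_one_iff_of_nonneg hp0 j.succ_ne_zero).not.mpr hp1

theorem c_ne_zero (hq0 : 0 < q) (hq1 : q ≠ 1) : c q r σ ≠ 0 := by
  have hsq := sq_ne_one_of_pos hq0 hq1
  exact mul_ne_zero
    (pow_ne_zero _ (div_ne_zero (Real.rpow_pos_of_pos hq0 σ).ne' (sub_ne_zero.mpr hsq)))
    (qPoch_self_ne_zero (sq_nonneg q) hsq r)

theorem ct_ne_zero (hq0 : 0 < q) (hq1 : q ≠ 1) : ct l q r σ ≠ 0 := by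
  have hsq := sq_ne_one_of_pos hq0 hq1
  have hnum : q ^ (σ - 1) * q ^ (2 * (1 - (l : ℤ))) ≠ 0 :=
    mul_ne_zero (Real.rpow_pos_of_pos hq0 _).ne' (zpow_ne_zero _ hq0.ne')
  exact mul_ne_zero (pow_ne_zero _ (div_ne_zero hnum (sub_ne_zero.mpr hsq)))
    (qPoch_self_ne_zero (sq_nonneg q) hsq r)

theorem prod_J_mul_qFactorial (hq : q ^ 2 ≠ 1) (hln : 2 * l ≤ n) {I : Finset (Fin n)}
    (hI : I ∈ idx n l r) :
    (∏ i ∈ I, J n l q σ i i.rev) * qFactorial (q ^ 2) r = c q r σ := by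
  obtain ⟨houter, hcard, -⟩ := mem_idx_iff.mp hI
  rw [c, div_pow_mul_qPoch_eq hq, Finset.prod_congr rfl fun i hi => J_apply_rev hln (houter i hi),
    Finset.prod_const, hcard]

theorem twoRho_image_rev (I : Finset (Fin n)) :
    twoRho (I.image Fin.rev) = ((∑ i ∈ I, 2 * (i : ℕ) : ℕ) : ℤ) := by
  rw [twoRho, Finset.sum_image Fin.rev_injective.injOn]
  push_cast
  refine Finset.sum_congr rfl fun i _ => ?_
  rw [Fin.val_rev]
  omega

theorem prod_Jt_mul_qFactorial (hq : q ≠ 0) (hq' : q ^ 2 ≠ 1) (hln : 2 * l ≤ n)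
    {I : Finset (Fin n)} (hI : I ∈ idx n l r) :
    (∏ i ∈ I, Jt n l q σ i i.rev) * qFactorial (q ^ 2) r
      = ct l q r σ * q ^ twoRho (I.image Fin.rev) := by
  obtain ⟨houter, hcard, -⟩ := mem_idx_iff.mp hI
  rw [ct, div_pow_mul_qPoch_eq hq',
    Finset.prod_congr rfl fun i hi => Jt_apply_rev hq hln (houter i hi),
    Finset.prod_mul_distrib, Finset.prod_const, hcard, twoRho_image_rev, zpow_natCast,
    Finset.prod_pow_eq_pow_sum]
  ring

variable {ρ : L n q →ₐ[ℂ] L n q ⊗[ℂ] Aq n q} {ρd : Ld n q →ₐ[ℂ] Ld n q ⊗[ℂ] Aq n q}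

theorem principalTerm_PsiHat_w (hq0 : 0 < q) (hq1 : q ≠ 1) (hln : 2 * l ≤ n) (hrl : r ≤ l)
    (hρ : IsCoactionL ρ) (hρd : IsCoactionLd ρd) :
    principalTerm (tensorCoaction ρ.toLinearMap ρd.toLinearMap) l r
        (incl n q r (PsiHat n q r (pow r (w n l q σ))))
      = (c q r σ : ℂ) • u n l q r := by
  rw [w, principalTerm_PsiHat_pow hq0.ne' hln hrl hρ hρd fun _ _ => eq_or_eq_rev_of_J_ne_zero, u,
    Finset.smul_sum]
  refine Finset.sum_congr rfl fun I hI => ?_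
  rw [prod_J_mul_qFactorial (sq_ne_one_of_pos hq0 hq1) hln hI]

theorem principalTerm_PsiHat_wt (hq0 : 0 < q) (hq1 : q ≠ 1) (hln : 2 * l ≤ n) (hrl : r ≤ l)
    (hρ : IsCoactionL ρ) (hρd : IsCoactionLd ρd) :
    principalTerm (tensorCoaction ρ.toLinearMap ρd.toLinearMap) l r
        (incl n q r (PsiHat n q r (pow r (wt n l q σ))))
      = (ct l q r σ : ℂ) • ut n l q r := by
  rw [wt, principalTerm_PsiHat_pow hq0.ne' hln hrl hρ hρd fun _ _ => eq_or_eq_rev_of_Jt_ne_zero, ut,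
    Finset.smul_sum]
  refine Finset.sum_congr rfl fun I hI => ?_
  rw [prod_Jt_mul_qFactorial hq0.ne' (sq_ne_one_of_pos hq0 hq1) hln hI, smul_smul]
  push_cast
  rfl

end Constants

end QGrass

theorem mainTheorem6_general (n l r : ℕ) (q : ℝ) (hln : 2 * l ≤ n) (hrl : r ≤ l)
    (hq0 : 0 < q) (hq1 : q ≠ 1) :
    Function.Surjective (QGrass.PsiHat n q r) ∧
    ∃ (ρ : QGrass.L n q →ₐ[ℂ] QGrass.L n q ⊗[ℂ] QGrass.Aq n q)
      (ρd : QGrass.Ld n q →ₐ[ℂ] QGrass.Ld n q ⊗[ℂ] QGrass.Aq n q),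
      QGrass.IsCoactionL ρ ∧ QGrass.IsCoactionLd ρd ∧
      QGrass.IsIntertwiner (QGrass.coactSrc n q r)
        (QGrass.tensorCoaction ρ.toLinearMap ρd.toLinearMap)
        (QGrass.incl n q r ∘ₗ QGrass.PsiHat n q r) ∧
      ∀ σ : ℝ,
        QGrass.principalTerm (QGrass.tensorCoaction ρ.toLinearMap ρd.toLinearMap) l r
            (QGrass.incl n q r (QGrass.PsiHat n q r (QGrass.pow r (QGrass.w n l q σ))))
          = (QGrass.c q r σ : ℂ) • QGrass.u n l q r ∧
        QGrass.principalTerm (QGrass.tensorCoaction ρ.toLinearMap ρd.toLinearMap) l r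
            (QGrass.incl n q r (QGrass.PsiHat n q r (QGrass.pow r (QGrass.wt n l q σ))))
          = (QGrass.ct l q r σ : ℂ) • QGrass.ut n l q r ∧
        QGrass.c q r σ ≠ 0 ∧ QGrass.ct l q r σ ≠ 0 := by
  obtain ⟨ρ, hρ⟩ := QGrass.exists_isCoactionL (n := n) hq0.ne'
  obtain ⟨ρd, hρd⟩ := QGrass.exists_isCoactionLd (n := n) hq0.ne'
  exact ⟨QGrass.PsiHat_surjective hq0.ne', ρ, ρd, hρ, hρd,
    QGrass.PsiHat_intertwiner hq0.ne' hρ hρd, fun σ =>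
      ⟨QGrass.principalTerm_PsiHat_w hq0 hq1 hln hrl hρ hρd,
        QGrass.principalTerm_PsiHat_wt hq0 hq1 hln hrl hρ hρd,
        QGrass.c_ne_zero hq0 hq1, QGrass.ct_ne_zero hq0 hq1⟩⟩

theorem mainTheorem6 (n l r : ℕ) (q : ℝ) (hn : 2 ≤ n) (hl : 1 ≤ l) (hln : 2 * l ≤ n)
    (hr : 1 ≤ r) (hrl : r ≤ l) (hq0 : 0 < q) (hq1 : q < 1) :
    Function.Surjective (QGrass.PsiHat n q r) ∧
    ∃ (ρ : QGrass.L n q →ₐ[ℂ] QGrass.L n q ⊗[ℂ] QGrass.Aq n q)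
      (ρd : QGrass.Ld n q →ₐ[ℂ] QGrass.Ld n q ⊗[ℂ] QGrass.Aq n q),
      QGrass.IsCoactionL ρ ∧ QGrass.IsCoactionLd ρd ∧
      QGrass.IsIntertwiner (QGrass.coactSrc n q r)
        (QGrass.tensorCoaction ρ.toLinearMap ρd.toLinearMap)
        (QGrass.incl n q r ∘ₗ QGrass.PsiHat n q r) ∧
      ∀ σ : ℝ,
        QGrass.principalTerm (QGrass.tensorCoaction ρ.toLinearMap ρd.toLinearMap) l r
            (QGrass.incl n q r (QGrass.PsiHat n q r (QGrass.pow r (QGrass.w n l q σ))))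
          = (QGrass.c q r σ : ℂ) • QGrass.u n l q r ∧
        QGrass.principalTerm (QGrass.tensorCoaction ρ.toLinearMap ρd.toLinearMap) l r
            (QGrass.incl n q r (QGrass.PsiHat n q r (QGrass.pow r (QGrass.wt n l q σ))))
          = (QGrass.ct l q r σ : ℂ) • QGrass.ut n l q r ∧
        QGrass.c q r σ ≠ 0 ∧ QGrass.ct l q r σ ≠ 0 :=
  mainTheorem6_general n l r q hln hrl hq0 hq1.ne
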